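/- Let $\mathbb F$ be a finite field, let $\alpha,\beta,\gamma,K\ge 1$, and let $\mathcal S\subseteq[L_A]\times[L_B]$ be a nonempty set (the computation list). Two sources hold matrices $\mathbf A_i\in\mathbb F^{\alpha\times\beta}$ ($i\in[L_A]$) and $\mathbf B_j\in\mathbb F^{\beta\times\gamma}$ ($j\in[L_B]$). They send encoded matrices $\widetilde{\mathbf A}_k$ and $\widetilde{\mathbf B}_k$ to worker $k\in[K]$, which returns $\widetilde{\mathbf A}_k\widetilde{\mathbf B}_k$; for every set $\mathcal R\subseteq[K]$ of responding workers a decoding function $d_{\mathcal R}$ is applied to their responses. A task assignment $\mathcal Q$ for $\mathcal S$ consists of pairs $(\mathcal L_A^q,\mathcal L_B^q)$, $q=1,\dots,|\mathcal Q|$, of nonempty sets $\mathcal L_A^q\subseteq[L_A]$, $\mathcal L_B^q\subseteq[L_B]$, such that the products $\mathcal L_A^q\times\mathcal L_B^q$ are pairwise disjoint and every $s\in\mathcal S$ lies in exactly one of them. Put $L_A^q=|\mathcal L_A^q|$, $L_B^q=|\mathcal L_B^q|$. A power assignment $\mathcal P$ for $\mathcal Q$ consists of nonnegative integers $P_i^{A,q}$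 ($i\in[L_A]$) and $P_j^{B,q}$ ($j\in[L_B]$) such that, for each $q$: 1. $P_i^{A,q}=0$ for $i\notin\mathcal L_A^q$ and $P_j^{B,q}=0$ for $j\notin\mathcal L_B^q$; 2. either every $P_i^{A,q}$ with $i\in\mathcal L_A^q$ has the form $L_A^qL_B^q-x+1$ with $x\in[L_A^q]$ and every $P_j^{B,q}$ with $j\in\mathcal L_B^q$ has the form $yL_A^q$ with $y\in[L_B^q]$, or the same holds with the roles of $A$ and $B$ exchanged; 3. the nonzero $P_i^{A,q}$ are pairwise distinct, and the nonzero $P_j^{B,q}$ are pairwise distinct. Given distinct elements $f_1,\dots,f_{|\mathcal Q|},x_1,\dots,x_K$ of $\mathbb F$, an FCSA code sends $\widetilde{\mathbf A}_k=\mathbf A(x_k)$ and $\widetilde{\mathbf B}_k=\mathbf B(x_k)$ to worker $k$, where $$\mathbf A(x)=\prod_{q}(x-f_q)^{L_A^qL_B^q}\sum_{i=1}^{L_A}\frac{\mathbf A_i}{\prod_q(x-f_q)^{P_i^{A,q}}},\qquad \mathbf B(x)=\sum_{j=1}^{L_B}\frac{\mathbf B_j}{\prod_q(x-f_q)^{P_j^{B,q}}}.$$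 **Theorem 1 (Achievability of FCSA codes).** Assume $|\mathbb F|>|\mathcal Q|+K$, and put $$R_{FCSA}=2\sum_{q}L_A^qL_B^q-\min_{i\in[L_A]}\sum_{q}P_i^{A,q}-\min_{j\in[L_B]}\sum_{q}P_j^{B,q}+1 .$$ Then distinct $f_1,\dots,f_{|\mathcal Q|},x_1,\dots,x_K\in\mathbb F$ exist, and for every such choice there are decoding functions $(d_{\mathcal R})_{\mathcal R\subseteq[K]}$ for which the FCSA code has the following properties. * Recovery threshold: for every $\mathcal R\subseteq[K]$ with $|\mathcal R|\ge R_{FCSA}$ and all source matrices, $d_{\mathcal R}$ returns $\mathbf A_i\mathbf B_j$ for every $(i,j)\in\mathcal S$. If $R_{FCSA}\le K$, then $R_{FCSA}$ is the least integer with this property for the code with these decoding functions. * Upload costs: the average numbers of symbols sent to a worker by the two sources are $U_A=\alpha\beta$ and $U_B=\beta\gamma$. * Download cost: if $R_{FCSA}\le K$, the worst-case average number of symbols downloaded per worker from $R_{FCSA}$ responding workers is $D_C=\alpha\gamma$. * Encoding complexities: $C_A=\mathcal O(\alpha\beta KL_A)$ and $C_B=\mathcal O(\beta\gamma KL_B)$.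 * Worker complexity (average over the workers): $C_w=\mathcal O(\alpha\beta\gamma)$. * Decoding complexity (worst case over the sets of $R_{FCSA}$ responding workers): $$C_d=\mathcal O\Big(\alpha\gamma\Big(R_{FCSA}\log^2(R_{FCSA})\,\max\{1,\log\log R_{FCSA}\}+\sum_{q}(L_A^qL_B^q)^2\Big)\Big).$$ Complexity is the least number of additions, subtractions and multiplications in $\mathbb F$ of a straight-line program (for the fixed code and the fixed set of responding workers) whose inputs are the entries of the given matrices and which may use constants of $\mathbb F$ free of charge. The constants in the $\mathcal O$'s are absolute: they do not depend on $\mathbb F$, $\alpha,\beta,\gamma,K,L_A,L_B,\mathcal S,\mathcal Q,\mathcal P$, the points, or $\mathcal R$. -/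

import Mathlib

open scoped ENNReal BigOperators

noncomputable section

/-! ### Arithmetic cost: straight-line programs over a field -/

/-- `StraightLine n V`: some straight-line program with `n` arithmetic instructions over `F`, on inputs
indexed by `ι`, makes exactly the functions in `V` available (inputs, constants of `F`, and the results
of its instructions).  Inputs and constants are free; each addition, subtraction and multiplication of
two available quantities costs one step.  There are no divisions. -/
inductive StraightLine {F ι : Type*} [Field F] : ℕ → Set ((ι → F) → F) → Prop
  | start : StraightLine 0
      (Set.range (fun (i : ι) (v : ι → F) => v i) ∪ Set.range (fun (c : F) (_ : ι → F) => c))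
  | add {n : ℕ} {V : Set ((ι → F) → F)} {a b : (ι → F) → F} :
      StraightLine n V → a ∈ V → b ∈ V → StraightLine (n + 1) (insert (fun v => a v + b v) V)
  | sub {n : ℕ} {V : Set ((ι → F) → F)} {a b : (ι → F) → F} :
      StraightLine n V → a ∈ V → b ∈ V → StraightLine (n + 1) (insert (fun v => a v - b v) V)
  | mul {n : ℕ} {V : Set ((ι → F) → F)} {a b : (ι → F) → F} :
      StraightLine n V → a ∈ V → b ∈ V → StraightLine (n + 1) (insert (fun v => a v * b v) V)

/-- `g` is computed by a straight-line program with `n` arithmetic instructions. -/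
def ComputedIn {F ι κ : Type*} [Field F] (g : (ι → F) → (κ → F)) (n : ℕ) : Prop :=
  ∃ V : Set ((ι → F) → F), StraightLine n V ∧ ∀ o : κ, (fun v => g v o) ∈ V

/-- The arithmetic complexity of `g`: the least number of arithmetic operations of a straight-line
program that computes all outputs of `g` (it is `∞` if there is none). -/
def arithCost {F ι κ : Type*} [Field F] (g : (ι → F) → (κ → F)) : ℝ≥0∞ :=
  ⨅ (n : ℕ) (_ : ComputedIn g n), (n : ℝ≥0∞)

/-! ### Codes for variable coded distributed batch matrix multiplication -/

/-- A code `(f, g, d)` for the computation list `S`: the sources hold `A_i ∈ F^{α × β}` and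
`B_j ∈ F^{β × γ}`, worker `k` is sent a `rowDim k × midDim k` and a `midDim k × colDim k` matrix, and
`dec 𝓡` is the decoding function used when `𝓡` is the set of responding workers; its output is indexed
by the pairs in `S`. -/
structure BatchCode (F : Type*) [Field F] {LA LB : ℕ} (S : Finset (Fin LA × Fin LB))
    (α β γ K : ℕ) where
  rowDim : Fin K → ℕ
  midDim : Fin K → ℕ
  colDim : Fin K → ℕ
  encA : (Fin LA → Matrix (Fin α) (Fin β) F) →
    (k : Fin K) → Matrix (Fin (rowDim k)) (Fin (midDim k)) F
  encB : (Fin LB → Matrix (Fin β) (Fin γ) F) →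
    (k : Fin K) → Matrix (Fin (midDim k)) (Fin (colDim k)) F
  dec : (𝓡 : Finset (Fin K)) → ((k : 𝓡) → Matrix (Fin (rowDim k)) (Fin (colDim k)) F) →
    S → Matrix (Fin α) (Fin γ) F

namespace BatchCode

variable {F : Type*} [Field F] {LA LB : ℕ} {S : Finset (Fin LA × Fin LB)} {α β γ K : ℕ}

/-- For every set of at least `R` responding workers and all source matrices, the decoder returns
`A_i B_j` for every `(i, j) ∈ S`. -/
def RecoversFrom (code : BatchCode F S α β γ K) (R : ℤ) : Prop :=
  ∀ 𝓡 : Finset (Fin K), R ≤ (𝓡.card : ℤ) →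
    ∀ (A : Fin LA → Matrix (Fin α) (Fin β) F) (B : Fin LB → Matrix (Fin β) (Fin γ) F) (s : S),
      code.dec 𝓡 (fun k => code.encA A k * code.encB B k) s = A s.1.1 * B s.1.2

/-- `R` is the recovery threshold: the minimum integer from which recovery is guaranteed. -/
def IsRecoveryThreshold (code : BatchCode F S α β γ K) (R : ℤ) : Prop :=
  IsLeast {r : ℤ | code.RecoversFrom r} R

/-- Average number of symbols sent from the first source to a worker. -/
def uploadCostA (code : BatchCode F S α β γ K) : ℝ≥0∞ :=
  (∑ k, (code.rowDim k : ℝ≥0∞) * code.midDim k) / K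

/-- Average number of symbols sent from the second source to a worker. -/
def uploadCostB (code : BatchCode F S α β γ K) : ℝ≥0∞ :=
  (∑ k, (code.midDim k : ℝ≥0∞) * code.colDim k) / K

/-- Worst-case average number of symbols downloaded per worker from `R` responding workers. -/
def downloadCost (code : BatchCode F S α β γ K) (R : ℤ) : ℝ≥0∞ :=
  ⨆ (𝓡 : Finset (Fin K)) (_ : (𝓡.card : ℤ) = R),
    (∑ k ∈ 𝓡, (code.rowDim k : ℝ≥0∞) * code.colDim k) / 𝓡.card

/-- Arithmetic complexity of producing all the transmissions of the first source. -/
def encodingComplexityA (code : BatchCode F S α β γ K) : ℝ≥0∞ :=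
  arithCost fun (v : Fin LA × Fin α × Fin β → F)
      (o : (k : Fin K) × (Fin (code.rowDim k) × Fin (code.midDim k))) =>
    code.encA (fun i => Matrix.of fun r c => v (i, r, c)) o.1 o.2.1 o.2.2

/-- Arithmetic complexity of producing all the transmissions of the second source. -/
def encodingComplexityB (code : BatchCode F S α β γ K) : ℝ≥0∞ :=
  arithCost fun (v : Fin LB × Fin β × Fin γ → F)
      (o : (k : Fin K) × (Fin (code.midDim k) × Fin (code.colDim k))) =>
    code.encB (fun j => Matrix.of fun r c => v (j, r, c)) o.1 o.2.1 o.2.2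

/-- Arithmetic complexity of multiplying an `a × b` by a `b × c` matrix over `F`. -/
def mulCost (F : Type*) [Field F] (a b c : ℕ) : ℝ≥0∞ :=
  arithCost fun (v : (Fin a × Fin b) ⊕ (Fin b × Fin c) → F) (o : Fin a × Fin c) =>
    ((Matrix.of fun r t => v (Sum.inl (r, t))) * (Matrix.of fun t s => v (Sum.inr (t, s))) :
      Matrix (Fin a) (Fin c) F) o.1 o.2

/-- Average arithmetic complexity of the workers, each of which multiplies the two matrices it
receives. -/
def workerComplexity (code : BatchCode F S α β γ K) : ℝ≥0∞ :=
  (∑ k, mulCost F (code.rowDim k) (code.midDim k) (code.colDim k)) / K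

/-- Worst-case arithmetic complexity of decoding from `R` responses. -/
def decodingComplexity (code : BatchCode F S α β γ K) (R : ℤ) : ℝ≥0∞ :=
  ⨆ (𝓡 : Finset (Fin K)) (_ : (𝓡.card : ℤ) = R),
    arithCost fun (v : (k : 𝓡) × (Fin (code.rowDim k) × Fin (code.colDim k)) → F)
        (o : S × Fin α × Fin γ) =>
      code.dec 𝓡 (fun k => Matrix.of fun r c => v ⟨k, (r, c)⟩) o.1 o.2.1 o.2.2

end BatchCode

/-! ### Task and power assignments -/

/-- A task assignment with `m` groups for the computation list `S`. -/
structure TaskAssignment {LA LB : ℕ} (S : Finset (Fin LA × Fin LB)) (m : ℕ) where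
  groupA : Fin m → Finset (Fin LA)
  groupB : Fin m → Finset (Fin LB)
  nonemptyA : ∀ q, (groupA q).Nonempty
  nonemptyB : ∀ q, (groupB q).Nonempty
  disjoint : ∀ q q', q ≠ q' → Disjoint (groupA q ×ˢ groupB q) (groupA q' ×ˢ groupB q')
  cover : ∀ s ∈ S, ∃! q, s ∈ groupA q ×ˢ groupB q

namespace TaskAssignment

variable {LA LB m : ℕ} {S : Finset (Fin LA × Fin LB)}

/-- The number of indices of the first source in group `q`. -/
def sizeA (Q : TaskAssignment S m) (q : Fin m) : ℕ := (Q.groupA q).card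

/-- The number of indices of the second source in group `q`. -/
def sizeB (Q : TaskAssignment S m) (q : Fin m) : ℕ := (Q.groupB q).card

end TaskAssignment

/-- A power assignment for a task assignment.  The equation `powA q i + x = sizeA * sizeB + 1` says
`powA q i = sizeA * sizeB - x + 1`. -/
structure PowerAssignment {LA LB m : ℕ} {S : Finset (Fin LA × Fin LB)}
    (Q : TaskAssignment S m) where
  powA : Fin m → Fin LA → ℕ
  powB : Fin m → Fin LB → ℕ
  zeroA : ∀ q, ∀ i ∉ Q.groupA q, powA q i = 0
  zeroB : ∀ q, ∀ j ∉ Q.groupB q, powB q j = 0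
  form : ∀ q,
    ((∀ i ∈ Q.groupA q, ∃ x ∈ Finset.Icc 1 (Q.sizeA q), powA q i + x = Q.sizeA q * Q.sizeB q + 1) ∧
      (∀ j ∈ Q.groupB q, ∃ y ∈ Finset.Icc 1 (Q.sizeB q), powB q j = y * Q.sizeA q)) ∨
    ((∀ j ∈ Q.groupB q, ∃ x ∈ Finset.Icc 1 (Q.sizeB q), powB q j + x = Q.sizeA q * Q.sizeB q + 1) ∧
      (∀ i ∈ Q.groupA q, ∃ y ∈ Finset.Icc 1 (Q.sizeA q), powA q i = y * Q.sizeB q))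
  distinctA : ∀ q i i', powA q i ≠ 0 → powA q i' ≠ 0 → powA q i = powA q i' → i = i'
  distinctB : ∀ q j j', powB q j ≠ 0 → powB q j' ≠ 0 → powB q j = powB q j' → j = j'

/-! ### FCSA codes -/

/-- `2 Σ_q L_A^q L_B^q - min_i Σ_q P_i^{A,q} - min_j Σ_q P_j^{B,q} + 1`, as an integer. -/
def fcsaThreshold {LA LB m : ℕ} {S : Finset (Fin LA × Fin LB)} (Q : TaskAssignment S m)
    (P : PowerAssignment Q) : ℤ :=
  2 * ∑ q, (Q.sizeA q : ℤ) * Q.sizeB q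
    - ((⨅ i, ∑ q, P.powA q i : ℕ) : ℤ) - ((⨅ j, ∑ q, P.powB q j : ℕ) : ℤ) + 1

/-- `∏_q (x - f_q)^{e_q}`. -/
def poleProd {F : Type*} [Field F] {m : ℕ} (f : Fin m → F) (e : Fin m → ℕ) (x : F) : F :=
  ∏ q, (x - f q) ^ e q

/-- The FCSA code with poles `f_q = pts (inl q)` and evaluation points `x_k = pts (inr k)`, all distinct,
and with decoder `d`.  Worker `k` is sent `A(x_k)` and `B(x_k)`, where
`A(x) = Θ(x) Σ_i A_i / a_i(x)`, `B(x) = Σ_j B_j / b_j(x)`, `Θ(x) = ∏_q (x - f_q)^{L_A^q L_B^q}`,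
`a_i(x) = ∏_q (x - f_q)^{P_i^{A,q}}` and `b_j(x) = ∏_q (x - f_q)^{P_j^{B,q}}`. -/
def fcsaCode {F : Type*} [Field F] {LA LB m : ℕ} {S : Finset (Fin LA × Fin LB)}
    (Q : TaskAssignment S m) (P : PowerAssignment Q) (α β γ : ℕ) {K : ℕ}
    (pts : Fin m ⊕ Fin K ↪ F)
    (d : (𝓡 : Finset (Fin K)) → (𝓡 → Matrix (Fin α) (Fin γ) F) → S → Matrix (Fin α) (Fin γ) F) :
    BatchCode F S α β γ K where
  rowDim _ := α
  midDim _ := β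
  colDim _ := γ
  encA A k :=
    let f : Fin m → F := fun q => pts (Sum.inl q)
    let x : F := pts (Sum.inr k)
    poleProd f (fun q => Q.sizeA q * Q.sizeB q) x •
      ∑ i, (poleProd f (fun q => P.powA q i) x)⁻¹ • A i
  encB B k :=
    let f : Fin m → F := fun q => pts (Sum.inl q)
    let x : F := pts (Sum.inr k)
    ∑ j, (poleProd f (fun q => P.powB q j) x)⁻¹ • B j
  dec := d

end

/-!
The decoder works on each of the `αγ` entries separately.  Multiplied by `Θ(x) = ∏_q (x - f_q)^{L_q}`,
with `L_q = L_A^q L_B^q`, an entry of the responses is the value of a polynomial `numerator`, of degree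
less than the threshold `R` by the definition of `R`: the coefficient of `A_i B_j` in it is
`∏_q (x - f_q)^{2 L_q - P_i^{A,q} - P_j^{B,q}}`.  So `R` responses determine it by interpolation.  The
form of the powers makes the exponents of `x - f_q` pairwise distinct and less than `L_q` on the
products of group `q`, and at least `L_q` on all other products.  Hence the products of group `q` are
linear functionals of the numerator modulo `(x - f_q)^{L_q}` (`eq_zero_of_pow_dvd_numerator`,
`exists_group_functional`), evaluated with `O(L_q²)` operations.  For the same reason the numerator
determines all the products in the groups, so that `∑ L_q ≤ R` (`sum_groupSize_le`).
`R` is the least threshold of this decoder because it gives up on fewer than `R` responses.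

What remains is a fast interpolation followed by fast reductions modulo the `(x - f_q)^{L_q}`.  Since
all points are constants, both are trees of multiplications by fixed polynomials
(`Computes.lagrangeSum`, `Computes.multi_modByMonic`); a remainder is obtained from two such
multiplications by Barrett's formula `mod_eq_sub_barrett`, the inverse that it uses being a constant.
With trees of depth `O(log R)`, multiplication in degree `n` has to cost `O(n log n log log n)` over
every field, which may lack roots of unity.  This is the Schönhage–Strassen algorithm, with radix `2`
or `3`, whichever is invertible in the field (`Computes.coords_mul_step`, `Computes.primePow_mul`,
`Computes.poly_mul`): modulo the cyclotomic polynomial of order `r ^ (k + 1)` an element is a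
polynomial in `x` over the algebra of a lower order `r ^ (a + 1)` with `a ≈ k / 2`, which contains a root of
unity of sufficient order, namely its generator, and multiplication by that is a cyclic shift of
coefficients.

Operation counts are expressed by `Computes X Y c`: from the functions `X` the functions `Y` are
obtained by `c` further instructions.
-/

noncomputable section

/-! ### Cost of extending a straight-line program -/

/-- `Computes X Y c`: every straight-line program that has all the functions in `X` available can be
continued by at most `c` instructions so that all the functions in `Y` become available as well. -/
def Computes {F ι : Type*} [Field F] (X Y : Set ((ι → F) → F)) (c : ℕ) : Prop :=
  ∀ n V, StraightLine n V → X ⊆ V →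
    ∃ n' V', n' ≤ n + c ∧ StraightLine n' V' ∧ V ⊆ V' ∧ Y ⊆ V'

theorem StraightLine.const_mem {F ι : Type*} [Field F] {n : ℕ} {V : Set ((ι → F) → F)}
    (h : StraightLine n V) (c : F) : (fun _ : ι → F => c) ∈ V := by
  induction h with
  | start => exact Or.inr ⟨c, rfl⟩
  | add _ _ _ ih => exact Or.inr ih
  | sub _ _ _ ih => exact Or.inr ih
  | mul _ _ _ ih => exact Or.inr ih

namespace Computes

variable {F ι : Type*} [Field F] {X X' Y Y' Z : Set ((ι → F) → F)} {c c' : ℕ}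

theorem mono (h : Computes X Y c) (hX : X ⊆ X') (hY : Y' ⊆ Y) (hc : c ≤ c') :
    Computes X' Y' c' := fun n V hV hXV => by
  obtain ⟨n', V', h1, h2, h3, h4⟩ := h n V hV (hX.trans hXV)
  exact ⟨n', V', h1.trans (by omega), h2, h3, hY.trans h4⟩

theorem mono_cost (h : Computes X Y c) (hc : c ≤ c') : Computes X Y c' :=
  h.mono subset_rfl subset_rfl hc

theorem of_subset (h : Y ⊆ X) : Computes X Y 0 := fun n V hV hXV =>
  ⟨n, V, le_rfl, hV, subset_rfl, h.trans hXV⟩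

theorem of_forall_mem
    (h : ∀ f ∈ Y, f ∈ X ∨ (∃ a : F, f = fun _ => a)) : Computes X Y 0 := fun n V hV hXV => by
  refine ⟨n, V, le_rfl, hV, subset_rfl, fun f hf => ?_⟩
  rcases h f hf with h | ⟨a, rfl⟩
  · exact hXV h
  · exact hV.const_mem a

/-- The results of a first computation stay available for a second one. -/
theorem trans_union (h : Computes X Y c) (h' : Computes (X ∪ Y) Z c') :
    Computes X (Y ∪ Z) (c + c') := fun n V hV hXV => by
  obtain ⟨n', V', h1, h2, h3, h4⟩ := h n V hV hXV
  obtain ⟨n'', V'', g1, g2, g3, g4⟩ := h' n' V' h2 (Set.union_subset (hXV.trans h3) h4)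
  exact ⟨n'', V'', by omega, g2, h3.trans g3, Set.union_subset (h4.trans g3) g4⟩

theorem trans (h : Computes X Y c) (h' : Computes Y Z c') : Computes X Z (c + c') :=
  (h.trans_union (h'.mono Set.subset_union_right subset_rfl le_rfl)).mono subset_rfl
    Set.subset_union_right le_rfl

theorem union (h : Computes X Y c) (h' : Computes X Z c') : Computes X (Y ∪ Z) (c + c') :=
  h.trans_union (h'.mono Set.subset_union_left subset_rfl le_rfl)

theorem biUnion {κ : Type*} (s : Finset κ) {Y : κ → Set ((ι → F) → F)} {c : κ → ℕ}
    (h : ∀ i ∈ s, Computes X (Y i) (c i)) : Computes X (⋃ i ∈ s, Y i) (∑ i ∈ s, c i) := by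
  classical
  induction s using Finset.induction_on with
  | empty => exact of_subset (by simp)
  | insert a s ha ih =>
    rw [Finset.sum_insert ha, Finset.set_biUnion_insert]
    exact (h a (by simp)).union (ih fun i hi => h i (by simp [hi]))

theorem biUnion_const {κ : Type*} (s : Finset κ) {Y : κ → Set ((ι → F) → F)} {c : ℕ}
    (h : ∀ i ∈ s, Computes X (Y i) c) : Computes X (⋃ i ∈ s, Y i) (s.card * c) := by
  simpa using biUnion s h

theorem add (a b : (ι → F) → F) : Computes {a, b} {fun v => a v + b v} 1 := fun n V hV h =>
  ⟨n + 1, _, le_rfl, hV.add (a := a) (b := b) (h (by simp)) (h (by simp)),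
    Set.subset_insert _ _, by simp⟩

theorem sub (a b : (ι → F) → F) : Computes {a, b} {fun v => a v - b v} 1 := fun n V hV h =>
  ⟨n + 1, _, le_rfl, hV.sub (a := a) (b := b) (h (by simp)) (h (by simp)),
    Set.subset_insert _ _, by simp⟩

theorem mul (a b : (ι → F) → F) : Computes {a, b} {fun v => a v * b v} 1 := fun n V hV h =>
  ⟨n + 1, _, le_rfl, hV.mul (a := a) (b := b) (h (by simp)) (h (by simp)),
    Set.subset_insert _ _, by simp⟩

theorem const_mul (c : F) (a : (ι → F) → F) : Computes {a} {fun v => c * a v} 1 := fun n V hV h =>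
  ⟨n + 1, _, le_rfl, hV.mul (b := a) (hV.const_mem c) (h (by simp)),
    Set.subset_insert _ _, by simp⟩

/-- Adding up the values of a family, each obtained at cost `c`. -/
theorem sum {κ : Type*} (s : Finset κ) {f : κ → (ι → F) → F} {c : ℕ}
    (h : ∀ i ∈ s, Computes X {f i} c) :
    Computes X {fun v => ∑ i ∈ s, f i v} (s.card * (c + 1)) := by
  classical
  induction s using Finset.induction_on with
  | empty =>
    refine (of_forall_mem fun f hf => Or.inr ⟨0, ?_⟩).mono_cost (Nat.zero_le _)
    rw [Set.mem_singleton_iff] at hf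
    rw [hf]; rfl
  | insert a s ha ih =>
    have h1 := (h a (by simp)).union (ih fun i hi => h i (by simp [hi]))
    refine (h1.trans ((add (f a) fun v => ∑ i ∈ s, f i v).mono ?_ ?_ le_rfl)).mono_cost ?_
    · rw [Set.singleton_union]
    · simp [Finset.sum_insert ha]
    · rw [Finset.card_insert_of_notMem ha]; linarith

theorem linear_combination {κ : Type*} (s : Finset κ) (f : κ → (ι → F) → F) (a : κ → F) :
    Computes (⋃ i ∈ s, {f i}) {fun v => ∑ i ∈ s, a i * f i v} (s.card * 2) :=
  sum s fun i hi => (const_mul (a i) (f i)).mono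
    (Set.subset_biUnion_of_mem (u := fun i => {f i}) hi) subset_rfl le_rfl

end Computes

theorem arithCost_le {F ι κ : Type*} [Field F] {g : (ι → F) → (κ → F)} {c : ℕ}
    (h : Computes (Set.range fun (i : ι) (v : ι → F) => v i)
      (Set.range fun (o : κ) (v : ι → F) => g v o) c) : arithCost g ≤ c := by
  obtain ⟨n, V, h1, h2, -, h4⟩ := h 0 _ StraightLine.start Set.subset_union_left
  refine (iInf₂_le n ⟨V, h2, fun o => h4 ⟨o, rfl⟩⟩).trans ?_
  exact_mod_cast (by omega : n ≤ c)

/-! ### Arithmetic in an algebra with a power basis -/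

section Coordinates

variable {F ι A : Type*} [Field F] [CommRing A] [Algebra F A] {d : ℕ}
  (b : Module.Basis (Fin d) F A)

/-- The coordinate functions, in the basis `b`, of an element of `A` that depends on the inputs. -/
def coords (f : (ι → F) → A) : Set ((ι → F) → F) :=
  Set.range fun (j : Fin d) (v : ι → F) => b.repr (f v) j

namespace Computes

variable {X : Set ((ι → F) → F)} {c : ℕ}

theorem coords_of_forall {f : (ι → F) → A}
    (h : ∀ j, Computes X {fun v => b.repr (f v) j} c) : Computes X (coords b f) (d * c) := by
  have := biUnion_const (X := X) Finset.univ (fun j _ => h j)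
  refine this.mono subset_rfl ?_ (by simp)
  rintro _ ⟨j, rfl⟩
  simp only [Finset.mem_univ, Set.iUnion_true, Set.mem_iUnion, Set.mem_singleton_iff]
  exact ⟨j, rfl⟩

theorem coords_add (f g : (ι → F) → A) :
    Computes (coords b f ∪ coords b g) (coords b fun v => f v + g v) d := by
  refine (coords_of_forall b (c := 1) fun j => ?_).mono_cost (by simp)
  refine (add (fun v => b.repr (f v) j) (fun v => b.repr (g v) j)).mono ?_ (by simp) le_rfl
  rintro _ (rfl | rfl)
  · exact Or.inl ⟨j, rfl⟩
  · exact Or.inr ⟨j, rfl⟩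

theorem coords_sub (f g : (ι → F) → A) :
    Computes (coords b f ∪ coords b g) (coords b fun v => f v - g v) d := by
  refine (coords_of_forall b (c := 1) fun j => ?_).mono_cost (by simp)
  refine (sub (fun v => b.repr (f v) j) (fun v => b.repr (g v) j)).mono ?_ (by simp) le_rfl
  rintro _ (rfl | rfl)
  · exact Or.inl ⟨j, rfl⟩
  · exact Or.inr ⟨j, rfl⟩

theorem coords_smul (a : F) (f : (ι → F) → A) :
    Computes (coords b f) (coords b fun v => a • f v) d := by
  refine (coords_of_forall b (c := 1) fun j => ?_).mono_cost (by simp)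
  refine (const_mul a (fun v => b.repr (f v) j)).mono ?_ (by simp) le_rfl
  rintro _ rfl
  exact ⟨j, rfl⟩

theorem coords_sum {κ : Type*} (s : Finset κ) {f : κ → (ι → F) → A}
    (h : ∀ i ∈ s, Computes X (coords b (f i)) c) :
    Computes X (coords b fun v => ∑ i ∈ s, f i v) (s.card * (c + d)) := by
  classical
  induction s using Finset.induction_on with
  | empty =>
    refine (of_forall_mem fun f hf => Or.inr ⟨0, ?_⟩).mono_cost (Nat.zero_le _)
    obtain ⟨j, rfl⟩ := hf
    simp
  | insert a s ha ih =>
    have h1 := (h a (by simp)).union (ih fun i hi => h i (by simp [hi]))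
    refine (h1.trans ((coords_add b (f a) fun v => ∑ i ∈ s, f i v).mono ?_ ?_ le_rfl)).mono_cost ?_
    · exact subset_rfl
    · simp [Finset.sum_insert ha]
    · rw [Finset.card_insert_of_notMem ha]; linarith

/-- Multiplication by a fixed element is a linear map, so the matrix of that map gives a quadratic
bound. -/
theorem coords_mul_naive (g : A) (f : (ι → F) → A) :
    Computes (coords b f) (coords b fun v => g * f v) (d * (d * 2)) := by
  refine coords_of_forall b fun j => ?_
  have h := linear_combination (ι := ι) Finset.univ (fun (i : Fin d) v => b.repr (f v) i)
    (fun i => b.repr (g * b i) j)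
  refine h.mono ?_ ?_ (by simp)
  · simp only [Finset.mem_univ, Set.iUnion_true, Set.iUnion_singleton_eq_range]
    exact subset_rfl
  · rw [Set.singleton_subset_iff, Set.mem_singleton_iff]
    funext v
    conv_lhs => rw [← b.sum_repr (f v), Finset.mul_sum]
    simp only [mul_smul_comm, map_sum, map_smul, Finsupp.coe_finsetSum, Finset.sum_apply,
      Finsupp.smul_apply, smul_eq_mul]
    exact Finset.sum_congr rfl fun i _ => mul_comm _ _

end Computes

end Coordinates

theorem sum_range_mul_eq {M : Type*} [AddCommMonoid M] (r n : ℕ) (f : ℕ → M) :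
    ∑ i ∈ Finset.range (n * r), f i =
      ∑ j ∈ Finset.range n, ∑ l ∈ Finset.range r, f (r * j + l) := by
  induction n with
  | zero => simp
  | succ n ih => rw [Nat.succ_mul, Finset.sum_range_add, ih, Finset.sum_range_succ, mul_comm n r]

theorem sum_range_periodic_add {M : Type*} [AddCommMonoid M] {N : ℕ} {f : ℕ → M}
    (hf : ∀ i, f (i + N) = f i) (E : ℕ) :
    ∑ i ∈ Finset.range N, f (i + E) = ∑ i ∈ Finset.range N, f i := by
  induction E with
  | zero => rfl
  | succ E ih =>
    rw [← ih]
    have h1 := Finset.sum_range_succ (fun i => f (i + E)) N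
    have h2 := Finset.sum_range_succ' (fun i => f (i + E)) N
    rw [h1] at h2
    have h3 : f (N + E) = f (0 + E) := by rw [add_comm N E, hf, zero_add]
    cases N with
    | zero => simp
    | succ N =>
      rw [Finset.sum_range_succ, Finset.sum_range_succ']
      congr 1
      · exact Finset.sum_congr rfl fun i _ => by congr 1; ring
      · rw [← h3]; congr 1; ring

section RootPowers

variable {F ι A : Type*} [Field F] [CommRing A] [Algebra F A] {r q : ℕ}
  (b : Module.Basis (Fin ((r - 1) * q)) F A) {y : A}

theorem pow_eq_one_of_geom_sum_eq_zero {z : A} (hz : ∑ l ∈ Finset.range r, z ^ l = 0) :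
    z ^ r = 1 := by
  have := mul_geom_sum z r
  rw [hz, mul_zero] at this
  exact (sub_eq_zero.mp this.symm)

/-- Let `1, y, y², …` be a basis with `1 + y^q + ⋯ + y^{(r-1)q} = 0`.  Then multiplication by a power
of `y` is a cyclic shift of length `rq`, after which the top block of `q` coefficients is subtracted
from each of the others: one operation per coordinate. -/
theorem Computes.coords_pow_mul (hr : 0 < r) (hq : 0 < q) (hb : ∀ j, b j = y ^ (j : ℕ))
    (hy : ∑ l ∈ Finset.range r, (y ^ q) ^ l = 0) (e : ℕ) (f : (ι → F) → A) :
    Computes (coords b f) (coords b fun v => y ^ e * f v) ((r - 1) * q) := by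
  have hy1 : y ^ (r * q) = 1 := by
    rw [mul_comm, pow_mul]; exact pow_eq_one_of_geom_sum_eq_zero hy
  have hN : 0 < r * q := Nat.mul_pos hr hq
  -- `E` represents `-e` modulo `rq`
  obtain ⟨E, hE⟩ : ∃ E, r * q ∣ e + E := by
    refine ⟨e * (r * q) - e, e, ?_⟩
    have : e ≤ e * (r * q) := Nat.le_mul_of_pos_right e hN
    rw [mul_comm (r * q)]; omega
  let G : (ι → F) → ℕ → F := fun v i =>
    if h : i % (r * q) < (r - 1) * q then b.repr (f v) ⟨i % (r * q), h⟩ else 0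
  have hG : ∀ v i, G v (i + r * q) = G v i := fun v i => by simp [G]
  have hf : ∀ v, ∑ i ∈ Finset.range (r * q), algebraMap F A (G v i) * y ^ i = f v := by
    intro v
    have hsub : (r - 1) * q ≤ r * q := Nat.mul_le_mul_right q (by omega)
    rw [← Finset.sum_subset (Finset.range_mono hsub), Finset.sum_range]
    · conv_rhs => rw [← b.sum_repr (f v)]
      refine Finset.sum_congr rfl fun j _ => ?_
      have hj : (j : ℕ) % (r * q) = j := Nat.mod_eq_of_lt (j.2.trans_le hsub)
      have : G v j = b.repr (f v) j := by
        simp only [G, hj, j.2, dif_pos, Fin.eta]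
      rw [this, hb, Algebra.smul_def]
    · intro i hi hi'
      rw [Finset.mem_range] at hi hi'
      simp [G, Nat.mod_eq_of_lt hi, hi']
  have hshift : ∀ v, y ^ e * f v =
      ∑ i ∈ Finset.range (r * q), algebraMap F A (G v (i + E)) * y ^ i := by
    intro v
    have h1 := sum_range_periodic_add (N := r * q)
      (f := fun i => algebraMap F A (G v i) * y ^ i)
      (fun i => by simp only [hG, pow_add, hy1, mul_one]) E
    rw [hf v] at h1
    rw [← h1, Finset.mul_sum]
    refine Finset.sum_congr rfl fun i _ => ?_
    obtain ⟨k, hk⟩ := hE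
    have : y ^ e * y ^ (i + E) = y ^ i := by
      rw [← pow_add, show e + (i + E) = i + (e + E) by ring, pow_add, hk, pow_mul, hy1, one_pow,
        mul_one]
    rw [← this]; ring
  have hrepr : ∀ v (j : Fin ((r - 1) * q)), b.repr (y ^ e * f v) j =
      G v (j + E) - G v (q * (r - 1) + j % q + E) := by
    intro v j
    have key : y ^ e * f v = ∑ j : Fin ((r - 1) * q),
        (G v (j + E) - G v (q * (r - 1) + j % q + E)) • b j := by
      rw [hshift, sum_range_mul_eq]
      obtain ⟨r', rfl⟩ : ∃ r', r = r' + 1 := ⟨r - 1, by omega⟩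
      simp only [Nat.add_sub_cancel]
      rw [Finset.sum_range_succ]
      have htop : ∀ s, y ^ (q * r' + s) = -∑ l ∈ Finset.range r', y ^ (q * l + s) := by
        intro s
        rw [Finset.sum_range_succ] at hy
        have : ∑ l ∈ Finset.range r', y ^ (q * l + s) =
            (∑ l ∈ Finset.range r', (y ^ q) ^ l) * y ^ s := by
          rw [Finset.sum_mul]
          exact Finset.sum_congr rfl fun l _ => by rw [pow_add, pow_mul]
        rw [this, pow_add, pow_mul]
        linear_combination y ^ s * hy
      have hlast : ∑ s ∈ Finset.range q, algebraMap F A (G v (q * r' + s + E)) * y ^ (q * r' + s) =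
          -∑ l ∈ Finset.range r', ∑ s ∈ Finset.range q,
            algebraMap F A (G v (q * r' + s + E)) * y ^ (q * l + s) := by
        rw [Finset.sum_comm, ← Finset.sum_neg_distrib]
        refine Finset.sum_congr rfl fun s _ => ?_
        rw [htop, mul_neg, Finset.mul_sum]
      rw [hlast, ← sub_eq_add_neg, ← Finset.sum_sub_distrib]
      have := Finset.sum_range (n := r' * q) (fun j =>
        (G v (j + E) - G v (q * r' + j % q + E)) • y ^ j)
      simp only [hb]
      refine Eq.trans ?_ this
      rw [sum_range_mul_eq]
      refine Finset.sum_congr rfl fun l _ => ?_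
      rw [← Finset.sum_sub_distrib]
      refine Finset.sum_congr rfl fun s hs => ?_
      have hs' : (q * l + s) % q = s := by
        rw [Nat.mul_add_mod]; exact Nat.mod_eq_of_lt (Finset.mem_range.mp hs)
      rw [hs', Algebra.smul_def, map_sub, sub_mul]
    rw [key, b.repr_sum_self]
  have hmem : ∀ i, Computes (coords b f) {fun v => G v i} 0 := by
    intro i
    refine Computes.of_forall_mem ?_
    rintro _ rfl
    by_cases h : i % (r * q) < (r - 1) * q
    · left; exact ⟨⟨i % (r * q), h⟩, by simp only [G, h, dif_pos]⟩
    · right; exact ⟨0, by simp only [G, h, dif_neg, not_false_eq_true]⟩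
  refine (Computes.coords_of_forall b (c := 1) fun j => ?_).mono_cost (by simp)
  simp only [hrepr]
  have h1 := (hmem (j + E)).union (hmem (q * (r - 1) + j % q + E))
  rw [Set.singleton_union] at h1
  exact (h1.trans (Computes.sub _ _)).mono_cost (by simp)

end RootPowers

/-! ### Discrete Fourier transforms over an algebra with a root of unity -/

section Fourier

variable {F ι A : Type*} [Field F] [CommRing A] [Algebra F A] {d r : ℕ}
  (b : Module.Basis (Fin d) F A) {y : A}

/-- The radix-`r` fast Fourier transform of length `r ^ k` at a root of unity that is a power of `y`,
over an algebra in which multiplication by powers of `y` costs `d`. -/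
theorem Computes.dft
    (hy : ∀ (e : ℕ) (f : (ι → F) → A), Computes (coords b f) (coords b fun v => y ^ e * f v) d)
    (k s : ℕ) (hs : (y ^ s) ^ r ^ k = 1) (f : ℕ → (ι → F) → A) :
    Computes (⋃ i ∈ Finset.range (r ^ k), coords b (f i))
      (⋃ j ∈ Finset.range (r ^ k), coords b fun v =>
        ∑ i ∈ Finset.range (r ^ k), (y ^ s) ^ (i * j) * f i v)
      (r ^ k * (k * (r * (2 * d)))) := by
  induction k generalizing s f with
  | zero => exact (Computes.of_subset (by simp)).mono_cost (Nat.zero_le _)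
  | succ k ih =>
    let inner : ℕ → ℕ → (ι → F) → A := fun l j v =>
      ∑ i ∈ Finset.range (r ^ k), (y ^ (s * r)) ^ (i * j) * f (r * i + l) v
    have hs' : (y ^ (s * r)) ^ r ^ k = 1 := by
      rw [pow_mul, ← pow_mul, ← pow_succ', hs]
    have h1 : Computes (⋃ i ∈ Finset.range (r ^ (k + 1)), coords b (f i))
        (⋃ l ∈ Finset.range r, ⋃ j ∈ Finset.range (r ^ k), coords b (inner l j))
        (r * (r ^ k * (k * (r * (2 * d))))) := by
      refine (Computes.biUnion_const (Finset.range r) fun l hl =>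
        (ih (s * r) hs' fun i => f (r * i + l)).mono ?_ subset_rfl le_rfl).mono_cost (by simp)
      refine Set.iUnion₂_subset fun i hi => ?_
      refine Set.subset_biUnion_of_mem (u := fun i => coords b (f i)) (x := r * i + l) ?_
      rw [Finset.mem_range] at hl hi
      simp only [Finset.coe_range, Set.mem_Iio]
      calc r * i + l < r * (i + 1) := by linarith
        _ ≤ r * r ^ k := Nat.mul_le_mul_left _ hi
        _ = r ^ (k + 1) := by ring
    have hout : ∀ j v, ∑ i ∈ Finset.range (r ^ (k + 1)), (y ^ s) ^ (i * j) * f i v =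
        ∑ l ∈ Finset.range r, y ^ (s * (l * j)) * inner l (j % r ^ k) v := by
      intro j v
      rw [pow_succ, sum_range_mul_eq, Finset.sum_comm]
      refine Finset.sum_congr rfl fun l _ => ?_
      rw [Finset.mul_sum]
      refine Finset.sum_congr rfl fun i _ => ?_
      have : (y ^ (s * r)) ^ (i * (j % r ^ k)) = (y ^ (s * r)) ^ (i * j) := by
        conv_rhs => rw [← Nat.mod_add_div j (r ^ k), mul_add, pow_add,
          show i * (r ^ k * (j / r ^ k)) = r ^ k * (i * (j / r ^ k)) by ring,
          pow_mul _ (r ^ k), hs', one_pow, mul_one]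
      rw [this, ← mul_assoc, ← pow_mul, ← pow_mul, ← pow_add]
      congr 2
      ring
    have h2 := Computes.biUnion_const
      (X := ⋃ l ∈ Finset.range r, ⋃ j ∈ Finset.range (r ^ k), coords b (inner l j))
      (Y := fun j => coords b fun v =>
        ∑ i ∈ Finset.range (r ^ (k + 1)), (y ^ s) ^ (i * j) * f i v)
      (c := r * (d + d)) (Finset.range (r ^ (k + 1))) (fun j hj => by
        simp only [hout]
        refine (Computes.coords_sum b (c := d) (Finset.range r) fun l hl => ?_).mono_cost (by simp)
        refine (hy (s * (l * j)) (inner l (j % r ^ k))).mono ?_ subset_rfl le_rfl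
        have hr : 0 < r := by
          rw [Finset.mem_range] at hl; omega
        refine (Set.subset_biUnion_of_mem (u := fun j => coords b (inner l j)) ?_).trans
          (Set.subset_biUnion_of_mem
            (u := fun l => ⋃ j ∈ Finset.range (r ^ k), coords b (inner l j)) hl)
        simpa using Nat.mod_lt _ (Nat.pow_pos hr))
    refine (h1.trans h2).mono_cost (le_of_eq ?_)
    rw [Finset.card_range]
    ring

/-- Orthogonality of the powers of a principal root of unity of order `r ^ k`. -/
theorem sum_pow_mul_eq {R : Type*} [CommRing R] {ζ : R} (hr : 0 < r) (hζ1 : ζ ^ r = 1)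
    (hζ : ∀ t, ¬ r ∣ t → ∑ l ∈ Finset.range r, ζ ^ (l * t) = 0) (k : ℕ) (ω : R)
    (hω : ∀ k', k = k' + 1 → ω ^ r ^ k' = ζ) (t : ℕ) :
    ∑ j ∈ Finset.range (r ^ k), ω ^ (j * t) = if r ^ k ∣ t then (r ^ k : R) else 0 := by
  induction k generalizing ω t with
  | zero => simp
  | succ k ih =>
    have hfac : ∑ j ∈ Finset.range (r ^ (k + 1)), ω ^ (j * t) =
        (∑ j ∈ Finset.range (r ^ k), (ω ^ r) ^ (j * t)) * ∑ l ∈ Finset.range r, ω ^ (l * t) := by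
      rw [pow_succ, sum_range_mul_eq, Finset.sum_mul_sum]
      refine Finset.sum_congr rfl fun j _ => Finset.sum_congr rfl fun l _ => ?_
      rw [← pow_mul, ← pow_add]; congr 1; ring
    rw [hfac, ih (ω ^ r) fun k' hk' => by rw [← pow_mul, ← pow_succ', ← hk', hω k rfl]]
    by_cases h : r ^ k ∣ t
    · obtain ⟨t', rfl⟩ := h
      have h1 : ∀ l, ω ^ (l * (r ^ k * t')) = ζ ^ (l * t') := fun l => by
        rw [← hω k rfl, ← pow_mul]; congr 1; ring
      simp only [h1]
      rw [if_pos (Dvd.intro _ rfl), pow_succ, pow_succ (r : R)]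
      have hdvd : r ^ k * r ∣ r ^ k * t' ↔ r ∣ t' :=
        Nat.mul_dvd_mul_iff_left (Nat.pow_pos hr)
      by_cases h2 : r ∣ t'
      · rw [if_pos (hdvd.mpr h2)]
        obtain ⟨u, rfl⟩ := h2
        congr 1
        simp [show ∀ l, l * (r * u) = r * (l * u) by intros; ring, pow_mul, hζ1]
      · rw [if_neg (fun h3 => h2 (hdvd.mp h3)), hζ t' h2, mul_zero]
    · rw [if_neg h, if_neg fun h3 => h ((pow_dvd_pow r (Nat.le_succ k)).trans h3), zero_mul]

/-- Fourier inversion. -/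
theorem sum_dft_inv {R : Type*} [CommRing R] {ζ : R} (hr : 0 < r) (hζ1 : ζ ^ r = 1)
    (hζ : ∀ t, ¬ r ∣ t → ∑ l ∈ Finset.range r, ζ ^ (l * t) = 0) (k : ℕ) (ω : R)
    (hω : ∀ k', k = k' + 1 → ω ^ r ^ k' = ζ) (w : ℕ → R) {i : ℕ} (hi : i < r ^ k) :
    ∑ j ∈ Finset.range (r ^ k), (ω ^ (r ^ k - 1)) ^ (j * i) *
      (∑ a ∈ Finset.range (r ^ k), ω ^ (a * j) * w a) = (r ^ k : R) * w i := by
  have h1 : ∀ j, (ω ^ (r ^ k - 1)) ^ (j * i) * (∑ a ∈ Finset.range (r ^ k), ω ^ (a * j) * w a) =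
      ∑ a ∈ Finset.range (r ^ k), ω ^ (j * ((r ^ k - 1) * i + a)) * w a := by
    intro j
    rw [Finset.mul_sum]
    refine Finset.sum_congr rfl fun a _ => ?_
    rw [← mul_assoc, ← pow_mul, ← pow_add]
    congr 2; ring
  simp only [h1]
  rw [Finset.sum_comm]
  simp only [← Finset.sum_mul, sum_pow_mul_eq hr hζ1 hζ k ω hω]
  rw [Finset.sum_eq_single_of_mem i (Finset.mem_range.mpr hi)]
  · rw [if_pos]
    have : (r ^ k - 1) * i + i = r ^ k * i := by
      obtain ⟨m, hm⟩ : ∃ m, r ^ k = m + 1 := ⟨r ^ k - 1, by omega⟩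
      rw [hm, Nat.add_sub_cancel]; ring
    rw [this]
    exact Dvd.intro _ rfl
  · intro a ha hai
    rw [Finset.mem_range] at ha
    rw [if_neg, zero_mul]
    intro hd
    apply hai
    have h2 : (r ^ k - 1) * i + a + i = r ^ k * i + a := by
      obtain ⟨m, hm⟩ : ∃ m, r ^ k = m + 1 := ⟨r ^ k - 1, by omega⟩
      rw [hm, Nat.add_sub_cancel]; ring
    have h3 : i ≡ a [MOD r ^ k] := by
      have e1 : (r ^ k - 1) * i + a + i ≡ 0 + i [MOD r ^ k] :=
        Nat.ModEq.add_right _ ((Nat.modEq_zero_iff_dvd).mpr hd)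
      have e2 : r ^ k * i + a ≡ 0 + a [MOD r ^ k] :=
        Nat.ModEq.add_right _ ((Nat.modEq_zero_iff_dvd).mpr (Dvd.intro _ rfl))
      rw [h2] at e1
      simpa using e1.symm.trans e2
    exact (Nat.ModEq.eq_of_lt_of_lt h3 hi ha).symm

/-- The polynomial with coefficients `f 0, …, f (n - 1)`. -/
def polyOfCoeffs {R : Type*} [Semiring R] (n : ℕ) (f : ℕ → R) : Polynomial R :=
  ∑ i ∈ Finset.range n, Polynomial.monomial i (f i)

theorem degree_polyOfCoeffs_lt {R : Type*} [Semiring R] (n : ℕ) (f : ℕ → R) :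
    (polyOfCoeffs n f).degree < n := by
  rw [Polynomial.degree_lt_iff_coeff_zero]
  intro i hi
  simp [polyOfCoeffs, Polynomial.coeff_monomial, hi.not_gt]

theorem eval₂_polyOfCoeffs {R S : Type*} [CommSemiring R] [CommSemiring S] (φ : R →+* S) (x : S)
    (n : ℕ) (f : ℕ → R) :
    (polyOfCoeffs n f).eval₂ φ x = ∑ i ∈ Finset.range n, φ (f i) * x ^ i := by
  simp [polyOfCoeffs, Polynomial.eval₂_finsetSum, Polynomial.eval₂_monomial]

/-- A polynomial of degree less than `2n`, evaluated at an `n`-th root of `φ η`, depends only on its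
residue modulo `X ^ n - η`. -/
theorem eval₂_eq_sum_fold {R S : Type*} [CommSemiring R] [CommSemiring S] (φ : R →+* S) {x : S}
    {η : R} {n : ℕ} (hx : x ^ n = φ η) {p : Polynomial R} (hp : p.natDegree < 2 * n) :
    p.eval₂ φ x = ∑ i ∈ Finset.range n, φ (p.coeff i + η * p.coeff (i + n)) * x ^ i := by
  rw [Polynomial.eval₂_eq_sum_range' φ hp, two_mul, Finset.sum_range_add,
    ← Finset.sum_add_distrib]
  refine Finset.sum_congr rfl fun i _ => ?_
  rw [pow_add, hx, map_add, map_mul, add_comm n i]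
  ring

theorem natDegree_lt_of_degree_lt {R : Type*} [Semiring R] {n : ℕ} (hn : 0 < n) {p : Polynomial R}
    (hp : p.degree < n) : p.natDegree < n := by
  by_cases h : p = 0
  · simpa [h] using hn
  · exact (Polynomial.natDegree_lt_iff_degree_lt h).mpr hp

theorem natDegree_polyOfCoeffs_mul_lt {R : Type*} [Semiring R] {n : ℕ} (hn : 0 < n) (f : ℕ → R)
    {g : Polynomial R} (hg : g.degree < n) : (polyOfCoeffs n f * g).natDegree < 2 * n := by
  have h1 := natDegree_lt_of_degree_lt hn (degree_polyOfCoeffs_lt n f)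
  have h2 := natDegree_lt_of_degree_lt hn hg
  have := Polynomial.natDegree_mul_le (p := polyOfCoeffs n f) (q := g)
  omega

end Fourier

/-! ### Schönhage–Strassen recursion -/

section Convolution

variable {F ι A : Type*} [Field F] [CommRing A] [Algebra F A] {d r : ℕ}
  (b : Module.Basis (Fin d) F A) {y : A}

/-- Multiplication of a polynomial of degree less than `n = r ^ k` over `A` by a fixed one, modulo
`X ^ n - θ ^ n` with `θ = y ^ e`: twist by the powers of `θ`, transform, multiply pointwise (`n`
multiplications by fixed elements of `A`), transform back and untwist.  The relation `y ^ N = 1` makes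
the inverse of `θ` a power of `y` as well. -/
theorem Computes.twisted_convolution {τ k n s N : ℕ} {ζ : A} (hn : n = r ^ k)
    (hy : ∀ (e : ℕ) (f : (ι → F) → A), Computes (coords b f) (coords b fun v => y ^ e * f v) d)
    (hτ : ∀ (g : A) (f : (ι → F) → A), Computes (coords b f) (coords b fun v => g * f v) τ)
    (hr : 0 < r) (hrF : (r : F) ≠ 0) (hζ1 : ζ ^ r = 1)
    (hζ : ∀ t, ¬ r ∣ t → ∑ l ∈ Finset.range r, ζ ^ (l * t) = 0)
    (hN : 0 < N) (hyN : y ^ N = 1) (hs : ∀ k', k = k' + 1 → (y ^ s) ^ r ^ k' = ζ)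
    (hs1 : (y ^ s) ^ n = 1) (e : ℕ) {g : Polynomial A} (hg : g.degree < n)
    (f : ℕ → (ι → F) → A) :
    Computes (⋃ i ∈ Finset.range n, coords b (f i))
      (⋃ i ∈ Finset.range n, coords b fun v =>
        (polyOfCoeffs n (fun i => f i v) * g).coeff i +
          (y ^ e) ^ n * (polyOfCoeffs n (fun i => f i v) * g).coeff (i + n))
      (n * (4 * k * r * d + τ + 3 * d)) := by
  have hn0 : 0 < n := hn ▸ Nat.pow_pos hr
  let p : (ι → F) → Polynomial A := fun v => polyOfCoeffs n (fun i => f i v) * g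
  let w : ℕ → (ι → F) → A := fun i v => (p v).coeff i + (y ^ e) ^ n * (p v).coeff (i + n)
  let x : ℕ → A := fun j => y ^ e * (y ^ s) ^ j
  have hx : ∀ j, x j ^ n = (y ^ e) ^ n := fun j => by
    simp only [x]
    rw [mul_pow, ← pow_mul (y ^ s), mul_comm j, pow_mul, hs1, one_pow, mul_one]
  let f1 : ℕ → (ι → F) → A := fun i v => y ^ (e * i) * f i v
  let f2 : ℕ → (ι → F) → A := fun j v => ∑ i ∈ Finset.range n, (y ^ s) ^ (i * j) * f1 i v
  let f3 : ℕ → (ι → F) → A := fun j v => g.eval (x j) * f2 j v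
  let f4 : ℕ → (ι → F) → A := fun i v =>
    ∑ j ∈ Finset.range n, (y ^ (s * (n - 1))) ^ (j * i) * f3 j v
  let f5 : ℕ → (ι → F) → A := fun i v => (n : F)⁻¹ • f4 i v
  let f6 : ℕ → (ι → F) → A := fun i v => y ^ ((N - 1) * (e * i)) * f5 i v
  have map_step : ∀ (h h' : ℕ → (ι → F) → A) (c : ℕ),
      (∀ i, Computes (coords b (h i)) (coords b (h' i)) c) →
      Computes (⋃ i ∈ Finset.range n, coords b (h i)) (⋃ i ∈ Finset.range n, coords b (h' i))
        (n * c) := fun h h' c hh =>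
    (Computes.biUnion_const (Finset.range n) fun i hi => (hh i).mono
      (Set.subset_biUnion_of_mem (u := fun i => coords b (h i)) hi) subset_rfl
        le_rfl).mono_cost (by simp)
  have hs1' : (y ^ (s * (n - 1))) ^ n = 1 := by
    rw [pow_mul, ← pow_mul, mul_comm, pow_mul, hs1, one_pow]
  have c1 := map_step f f1 d fun i => hy _ _
  have c2 := Computes.dft b hy k s (hn ▸ hs1) f1
  have c3 := map_step f2 f3 τ fun j => hτ _ _
  have c4 := Computes.dft (r := r) b hy k (s * (n - 1)) (hn ▸ hs1') f3
  rw [← hn] at c2 c4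
  have c5 := map_step f4 f5 d fun i => Computes.coords_smul b _ _
  have c6 := map_step f5 f6 d fun i => hy _ _
  have hval : ∀ j v, f3 j v = ∑ a ∈ Finset.range n, (y ^ s) ^ (a * j) * ((y ^ e) ^ a * w a v) := by
    intro j v
    have h1 : f2 j v = (polyOfCoeffs n (fun i => f i v)).eval (x j) := by
      rw [Polynomial.eval, eval₂_polyOfCoeffs]
      refine Finset.sum_congr rfl fun i _ => ?_
      simp only [f1, x, RingHom.id_apply]
      rw [mul_pow, ← pow_mul, ← pow_mul, ← pow_mul, ← pow_mul, mul_comm i j, ← mul_assoc]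
      ring
    have h2 : f3 j v = (p v).eval₂ (RingHom.id A) (x j) := by
      simp only [f3, h1, p]
      rw [mul_comm, ← Polynomial.eval_mul, Polynomial.eval]
    have h3 : (p v).natDegree < 2 * n := natDegree_polyOfCoeffs_mul_lt hn0 _ hg
    rw [h2, eval₂_eq_sum_fold (RingHom.id A) (η := (y ^ e) ^ n) (hx j) h3]
    refine Finset.sum_congr rfl fun a _ => ?_
    simp only [RingHom.id_apply, w, x]
    rw [mul_pow, ← pow_mul (y ^ s), mul_comm j a]
    ring
  have hfin : ∀ i ∈ Finset.range n, f6 i = w i := by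
    intro i hi
    rw [Finset.mem_range] at hi
    funext v
    have h4 : f4 i v = (r ^ k : A) * ((y ^ e) ^ i * w i v) := by
      simp only [f4, hval, pow_mul y s]
      have h6 := sum_dft_inv hr hζ1 hζ k (y ^ s) hs (fun a => (y ^ e) ^ a * w a v) (hn ▸ hi)
      rwa [← hn] at h6
    have h5 : f5 i v = (y ^ e) ^ i * w i v := by
      simp only [f5]
      have hc : (r ^ k : A) = algebraMap F A (n : F) := by simp [hn]
      rw [h4, hc, ← Algebra.smul_def, smul_smul, inv_mul_cancel₀, one_smul]
      rw [hn]; push_cast; exact pow_ne_zero _ hrF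
    simp only [f6, h5]
    rw [← pow_mul, ← mul_assoc, ← pow_add]
    have : (N - 1) * (e * i) + e * i = N * (e * i) := by
      obtain ⟨m, rfl⟩ : ∃ m, N = m + 1 := ⟨N - 1, by omega⟩
      rw [Nat.add_sub_cancel]; ring
    rw [this, pow_mul, hyN, one_pow, one_mul]
  have hall := (((((c1.trans c2).trans c3).trans c4).trans c5).trans c6)
  refine hall.mono subset_rfl ?_ (le_of_eq ?_)
  · exact (Set.iUnion₂_congr fun i hi => by rw [hfin i hi]).symm.subset
  · ring

end Convolution

section Recursion

variable {F ι A B : Type*} [Field F] [CommRing A] [Algebra F A] [CommRing B] [Algebra F B]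

theorem sum_pow_mul_eq_zero {R : Type*} [CommRing R] {r : ℕ} (hr : r = 2 ∨ r = 3) {ζ : R}
    (hζ : ∑ l ∈ Finset.range r, ζ ^ l = 0) (t : ℕ) (ht : ¬ r ∣ t) :
    ∑ l ∈ Finset.range r, ζ ^ (l * t) = 0 := by
  have h1 := pow_eq_one_of_geom_sum_eq_zero hζ
  have h2 : ∀ l, ζ ^ (l * t) = (ζ ^ (t % r)) ^ l := fun l => by
    conv_lhs => rw [← Nat.mod_add_div t r, mul_add, pow_add,
      show l * (r * (t / r)) = r * (l * (t / r)) by ring, pow_mul _ r, h1, one_pow, mul_one]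
    rw [← pow_mul, mul_comm]
  simp only [h2]
  rw [Nat.dvd_iff_mod_eq_zero] at ht
  rcases hr with rfl | rfl
  · rw [show t % 2 = 1 by omega]; simpa using hζ
  · rcases (by omega : t % 3 = 1 ∨ t % 3 = 2) with h | h
    · rw [h]; simpa using hζ
    · rw [h]
      simp only [Finset.sum_range_succ, Finset.sum_range_zero] at hζ ⊢
      linear_combination hζ + ζ * h1

/-- `Σ l ζ^l = r / (ζ - 1)` for a principal `r`-th root of unity. -/
theorem sub_one_mul_sum_mul_pow {R : Type*} [CommRing R] {r : ℕ} {ζ : R}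
    (hζ : ∑ l ∈ Finset.range r, ζ ^ l = 0) :
    (ζ - 1) * ∑ l ∈ Finset.range r, (l : R) * ζ ^ l = r := by
  have key : ∀ m : ℕ, (ζ - 1) * ∑ l ∈ Finset.range m, (l : R) * ζ ^ l =
      m * ζ ^ m - ∑ l ∈ Finset.range m, ζ ^ (l + 1) := by
    intro m
    induction m with
    | zero => simp
    | succ m ih =>
      rw [Finset.sum_range_succ, mul_add, ih, Finset.sum_range_succ]
      push_cast; ring
  rw [key, pow_eq_one_of_geom_sum_eq_zero hζ]
  simp [pow_succ, ← Finset.sum_mul, hζ]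

/-- If `x` generates `B` with `x ^ n = φ y`, the coordinate of index `n * j + i` of
`∑ i < n, φ (h i) * x ^ i` is the `j`-th coordinate of `h i`. -/
theorem repr_sum_map_mul_pow {D n : ℕ} (b : Module.Basis (Fin D) F A)
    (b' : Module.Basis (Fin (D * n)) F B) {y : A} {x : B} (hb : ∀ j, b j = y ^ (j : ℕ))
    (hb' : ∀ j, b' j = x ^ (j : ℕ)) (φ : A →ₐ[F] B) (hφ : φ y = x ^ n) (h : ℕ → A)
    (j : Fin (D * n)) :
    b'.repr (∑ i ∈ Finset.range n, φ (h i) * x ^ i) j =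
      b.repr (h (j % n)) ⟨j / n, Nat.div_lt_of_lt_mul (mul_comm D n ▸ j.2)⟩ := by
  let c : A → ℕ → F := fun a i => if hi : i < D then b.repr a ⟨i, hi⟩ else 0
  have hc : ∀ a, φ a = ∑ i ∈ Finset.range D, c a i • x ^ (n * i) := by
    intro a
    conv_lhs => rw [← b.sum_repr a, map_sum]
    rw [Finset.sum_range]
    refine Finset.sum_congr rfl fun i _ => ?_
    rw [map_smul, hb, map_pow, hφ, ← pow_mul]
    simp [c]
  have key : ∑ i ∈ Finset.range n, φ (h i) * x ^ i =
      ∑ j : Fin (D * n), c (h (j % n)) (j / n) • b' j := by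
    simp only [hb']
    have := Finset.sum_range (n := D * n) (fun j => c (h (j % n)) (j / n) • x ^ j)
    refine Eq.trans ?_ this
    rw [sum_range_mul_eq, Finset.sum_comm]
    refine Finset.sum_congr rfl fun i hi => ?_
    rw [hc, Finset.sum_mul]
    refine Finset.sum_congr rfl fun l _ => ?_
    rw [Finset.mem_range] at hi
    rw [Nat.mul_add_mod, Nat.mod_eq_of_lt hi, Nat.mul_add_div (by omega), Nat.div_eq_of_lt hi,
      add_zero, smul_mul_assoc, pow_add]
  rw [key, b'.repr_sum_self]
  simp only [c]
  rw [dif_pos]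

/-- One level of the recursion.  An element of `B` is a polynomial of degree less than `n = r ^ k` in
`x` over `A`, where `x ^ n = y`.  The product of two such polynomials is recovered from its residues
modulo `X ^ n - 1` and `X ^ n - ζ`, where `ζ = y ^ (r ^ a)` is a primitive `r`-th root of unity; each
residue is a twisted convolution, so that `2n` multiplications in `A` are used. -/
theorem Computes.coords_mul_step {r a k n d τ : ℕ} (hn : n = r ^ k)
    (hd : d = (r - 1) * r ^ a) (hr : r = 2 ∨ r = 3) (hrF : (r : F) ≠ 0)
    (hka : k ≤ a) (b : Module.Basis (Fin d) F A)
    (b' : Module.Basis (Fin (d * n)) F B) {y : A} {x : B}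
    (hb : ∀ j, b j = y ^ (j : ℕ)) (hb' : ∀ j, b' j = x ^ (j : ℕ))
    (hy : ∑ l ∈ Finset.range r, (y ^ r ^ a) ^ l = 0) (φ : A →ₐ[F] B) (hφ : φ y = x ^ n)
    (hτ : ∀ (g : A) (f : (ι → F) → A), Computes (coords b f) (coords b fun v => g * f v) τ)
    (g : B) (f : (ι → F) → B) :
    Computes (coords b' f) (coords b' fun v => g * f v)
      (n * (2 * τ + (24 * k + 19) * d)) := by
  have hr0 : 0 < r := by omega
  have hn0 : 0 < n := hn ▸ Nat.pow_pos hr0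
  have hpow : ∀ (e : ℕ) (f : (ι → F) → A),
      Computes (coords b f) (coords b fun v => y ^ e * f v) d := by
    subst hd
    exact Computes.coords_pow_mul b hr0 (Nat.pow_pos hr0) hb hy
  set ζ := y ^ r ^ a with hζ
  have hζ1 : ζ ^ r = 1 := pow_eq_one_of_geom_sum_eq_zero hy
  have hζ2 := sum_pow_mul_eq_zero hr hy
  have hyN : y ^ r ^ (a + 1) = 1 := by rw [pow_succ, pow_mul, hζ1]
  -- the components over `A` of an element of `B`
  let comp : B → ℕ → A := fun z i => ∑ j : Fin d, (if h : n * j + i < d * n then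
    b'.repr z ⟨n * j + i, h⟩ else 0) • b j
  have hcomp : ∀ z, ∑ i ∈ Finset.range n, φ (comp z i) * x ^ i = z := by
    intro z
    refine b'.repr.injective (Finsupp.ext fun j => ?_)
    rw [repr_sum_map_mul_pow b b' hb hb' φ hφ, b.repr_sum_self]
    have : n * (j / n) + j % n = (j : ℕ) := Nat.div_add_mod _ _
    simp only [this, j.2, dif_pos, Fin.eta]
  let G : Polynomial A := polyOfCoeffs n (comp g)
  let p : (ι → F) → Polynomial A := fun v => polyOfCoeffs n (fun i => comp (f v) i) * G
  have hp : ∀ v, (p v).natDegree < 2 * n := fun v =>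
    natDegree_polyOfCoeffs_mul_lt hn0 _ (degree_polyOfCoeffs_lt _ _)
  let fc : ℕ → (ι → F) → A := fun i v => comp (f v) i
  let w0 : ℕ → (ι → F) → A := fun i v =>
    (p v).coeff i + (y ^ 0) ^ n * (p v).coeff (i + n)
  let w1 : ℕ → (ι → F) → A := fun i v =>
    (p v).coeff i + (y ^ r ^ (a - k)) ^ n * (p v).coeff (i + n)
  have hη : (y ^ r ^ (a - k)) ^ n = ζ := by
    rw [← pow_mul, hn, ← pow_add, Nat.sub_add_cancel hka]
  let δ : ℕ → (ι → F) → A := fun i v => w1 i v - w0 i v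
  let u : ℕ → (ι → F) → A := fun i v =>
    ∑ l ∈ Finset.range r, y ^ (r ^ a * l) * (((l : F) * (r : F)⁻¹) • δ i v)
  let yu : ℕ → (ι → F) → A := fun i v => y ^ 1 * u i v
  let t : ℕ → (ι → F) → A := fun i v => w0 i v - u i v
  let h : ℕ → (ι → F) → A := fun i v => t i v + yu i v
  -- `w1 - w0 = (ζ - 1) v` for the upper half `v` of the product, and `(ζ - 1)⁻¹ = r⁻¹ ∑ l, l ζ ^ l`
  have hu : ∀ i v, u i v = (p v).coeff (i + n) := by
    intro i v
    have hδ : δ i v = (ζ - 1) * (p v).coeff (i + n) := by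
      simp only [δ, w0, w1, hη, pow_zero, one_pow]; ring
    have hsum : u i v = algebraMap F A (r : F)⁻¹ *
        ((ζ - 1) * ∑ l ∈ Finset.range r, (l : A) * ζ ^ l) * (p v).coeff (i + n) := by
      simp only [u, hδ, Finset.mul_sum, Finset.sum_mul]
      refine Finset.sum_congr rfl fun l _ => ?_
      rw [Algebra.smul_def, map_mul, map_natCast, pow_mul, ← hζ]
      ring
    rw [hsum, sub_one_mul_sum_mul_pow hy, ← map_natCast (algebraMap F A) r, ← map_mul,
      inv_mul_cancel₀ hrF, map_one, one_mul]
  have hres : ∀ v, g * f v = ∑ i ∈ Finset.range n, φ (h i v) * x ^ i := by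
    intro v
    have h1 : g * f v = (p v).eval₂ (φ : A →+* B) x := by
      simp only [p, G]
      rw [Polynomial.eval₂_mul, eval₂_polyOfCoeffs, eval₂_polyOfCoeffs]
      have e1 := hcomp g
      have e2 := hcomp (f v)
      simp only [RingHom.coe_coe]
      rw [e1, e2, mul_comm]
    rw [h1, eval₂_eq_sum_fold (φ : A →+* B) (η := y) hφ.symm (hp v)]
    refine Finset.sum_congr rfl fun i _ => ?_
    simp only [RingHom.coe_coe]
    congr 2
    simp only [h, t, yu, hu, w0, pow_zero, one_pow, pow_one]
    ring
  have hs : ∀ k', k = k' + 1 → (y ^ r ^ (a + 1 - k)) ^ r ^ k' = ζ := by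
    intro k' hk'
    rw [← pow_mul, ← pow_add, show a + 1 - k + k' = a by omega]
  have hs1 : (y ^ r ^ (a + 1 - k)) ^ n = 1 := by
    rw [hn, ← pow_mul, ← pow_add, show a + 1 - k + k = a + 1 by omega, hyN]
  have hconv := fun e => Computes.twisted_convolution b hn hpow hτ hr0 hrF hζ1 hζ2
    (Nat.pow_pos hr0) hyN hs hs1 e (degree_polyOfCoeffs_lt n (comp g)) fc
  have c0 : Computes (coords b' f) (⋃ i ∈ Finset.range n, coords b (fc i)) 0 := by
    refine Computes.of_forall_mem fun F' hF' => ?_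
    simp only [Set.mem_iUnion] at hF'
    obtain ⟨i, -, j, rfl⟩ := hF'
    by_cases hij : n * (j : ℕ) + i < d * n
    · refine Or.inl ⟨⟨_, hij⟩, ?_⟩
      funext v
      simp only [fc, comp, b.repr_sum_self, dif_pos hij]
    · refine Or.inr ⟨0, ?_⟩
      funext v
      simp only [fc, comp, b.repr_sum_self, dif_neg hij]
  have c1 : Computes (⋃ i ∈ Finset.range n, coords b (fc i))
      ((⋃ i ∈ Finset.range n, coords b (w0 i)) ∪ ⋃ i ∈ Finset.range n, coords b (w1 i)) _ :=
    (hconv 0).union (hconv (r ^ (a - k)))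
  have c2 : ∀ i, Computes (coords b (w0 i) ∪ coords b (w1 i)) (coords b (h i)) (13 * d) := by
    intro i
    have s1 : Computes (coords b (w0 i) ∪ coords b (w1 i)) (coords b (δ i)) d :=
      (Computes.coords_sub b _ _).mono (Set.union_comm _ _).subset subset_rfl le_rfl
    have s2 : Computes (coords b (δ i)) (coords b (u i)) (9 * d) := by
      refine (Computes.coords_sum b (c := d + d) (Finset.range r) fun l _ =>
        (Computes.coords_smul b _ _).trans (hpow _ _)).mono_cost ?_
      rw [Finset.card_range]
      have : r ≤ 3 := by omega
      calc r * (d + d + d) ≤ 3 * (d + d + d) := Nat.mul_le_mul_right _ this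
        _ = 9 * d := by ring
    have s3 := (s1.trans s2).trans_union ((Computes.coords_sub b (w0 i) (u i)).mono
      (X' := coords b (w0 i) ∪ coords b (w1 i) ∪ coords b (u i))
      (Set.union_subset_union_left _ Set.subset_union_left) subset_rfl le_rfl)
    have s4 : Computes (coords b (u i) ∪ coords b (t i)) (coords b (t i) ∪ coords b (yu i))
        (0 + d) := (Computes.of_subset Set.subset_union_right).union
      ((hpow 1 (u i)).mono Set.subset_union_left subset_rfl le_rfl)
    exact ((s3.trans s4).trans (Computes.coords_add b (t i) (yu i))).mono_cost (by omega)
  have c3 := Computes.biUnion_const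
    (X := (⋃ i ∈ Finset.range n, coords b (w0 i)) ∪ ⋃ i ∈ Finset.range n, coords b (w1 i))
    (Finset.range n) fun i hi => (c2 i).mono (Set.union_subset_union
      (Set.subset_biUnion_of_mem (u := fun i => coords b (w0 i)) hi)
      (Set.subset_biUnion_of_mem (u := fun i => coords b (w1 i)) hi)) subset_rfl le_rfl
  have c4 : Computes (⋃ i ∈ Finset.range n, coords b (h i)) (coords b' fun v => g * f v) 0 := by
    refine Computes.of_subset ?_
    rintro _ ⟨j, rfl⟩
    simp only [Set.mem_iUnion]
    refine ⟨j % n, by simpa using Nat.mod_lt _ hn0,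
      ⟨j / n, Nat.div_lt_of_lt_mul (mul_comm d n ▸ j.2)⟩, ?_⟩
    funext v
    rw [hres v, repr_sum_map_mul_pow b b' hb hb' φ hφ (fun i => h i v)]
  refine (((c0.trans c1).trans c3).trans c4).mono_cost ?_
  rw [Finset.card_range]
  have h4 : 4 * k * r * d ≤ 12 * (k * d) := by
    calc 4 * k * r * d = 4 * r * (k * d) := by ring
      _ ≤ 12 * (k * d) := Nat.mul_le_mul_right _ (by omega)
  calc 0 + (n * (4 * k * r * d + τ + 3 * d) + n * (4 * k * r * d + τ + 3 * d)) + n * (13 * d) + 0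
      = n * (2 * (4 * k * r * d) + 2 * τ + 19 * d) := by ring
    _ ≤ n * (2 * (12 * (k * d)) + 2 * τ + 19 * d) := by gcongr
    _ = _ := by ring

end Recursion

/-! ### Fast multiplication by a fixed polynomial -/

section RootPoly

open Polynomial

variable (F : Type*) [Field F] (r k : ℕ)

/-- `1 + X^q + X^{2q} + ⋯ + X^{(r-1)q}` with `q = r ^ k`, the cyclotomic polynomial of order
`r ^ (k + 1)` when `r` is prime.  Modulo it, `X` is a principal root of unity of that order. -/
def primePowPoly : F[X] := ∑ l ∈ Finset.range r, (X ^ r ^ k) ^ l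

variable {F r k}

theorem primePowPoly_eq (hr : 2 ≤ r) : primePowPoly F r k = X ^ ((r - 1) * r ^ k) +
    ∑ l ∈ Finset.range (r - 1), X ^ (r ^ k * l) := by
  obtain ⟨s, rfl⟩ : ∃ s, r = s + 1 := ⟨r - 1, by omega⟩
  rw [primePowPoly, Finset.sum_range_succ, add_comm, Nat.add_sub_cancel, mul_comm s, ← pow_mul]
  simp only [pow_mul]

theorem degree_primePowPoly_lower (hr : 2 ≤ r) :
    (∑ l ∈ Finset.range (r - 1), (X : F[X]) ^ (r ^ k * l)).degree < ((r - 1) * r ^ k : ℕ) := by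
  rw [degree_lt_iff_coeff_zero]
  intro m hm
  rw [finsetSum_coeff]
  refine Finset.sum_eq_zero fun l hl => ?_
  rw [coeff_X_pow, if_neg]
  rintro rfl
  rw [Finset.mem_range] at hl
  rw [mul_comm] at hm
  exact absurd (Nat.le_of_mul_le_mul_left hm (Nat.pow_pos (by omega))) (by omega)

theorem monic_primePowPoly (hr : 2 ≤ r) : (primePowPoly F r k).Monic := by
  rw [primePowPoly_eq hr]
  exact monic_X_pow_add (degree_primePowPoly_lower hr)

theorem natDegree_primePowPoly (hr : 2 ≤ r) :
    (primePowPoly F r k).natDegree = (r - 1) * r ^ k := by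
  rw [primePowPoly_eq hr, natDegree_add_eq_left_of_degree_lt, natDegree_X_pow]
  rw [degree_X_pow]
  exact degree_primePowPoly_lower hr

/-- The power basis of `F[X]` modulo `primePowPoly F r k`. -/
def primePowBasis (hr : 2 ≤ r) {D : ℕ} (hD : D = (r - 1) * r ^ k) :
    Module.Basis (Fin D) F (AdjoinRoot (primePowPoly F r k)) :=
  (AdjoinRoot.powerBasisAux' (monic_primePowPoly hr)).reindex
    (finCongr ((natDegree_primePowPoly hr).trans hD.symm))

theorem primePowBasis_repr (hr : 2 ≤ r) {D : ℕ} (hD : D = (r - 1) * r ^ k) (p : F[X])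
    (j : Fin D) : (primePowBasis hr hD).repr (AdjoinRoot.mk _ p) j =
      (p %ₘ primePowPoly F r k).coeff j := by
  rw [primePowBasis, Module.Basis.repr_reindex_apply, AdjoinRoot.powerBasisAux'_repr_apply_to_fun,
    AdjoinRoot.modByMonicHom_mk]
  simp

theorem primePowBasis_apply (hr : 2 ≤ r) {D : ℕ} (hD : D = (r - 1) * r ^ k) (j : Fin D) :
    primePowBasis hr hD j = AdjoinRoot.root (primePowPoly F r k) ^ (j : ℕ) := by
  rw [primePowBasis, Module.Basis.reindex_apply]
  exact (AdjoinRoot.powerBasis' (monic_primePowPoly hr)).basis_eq_pow _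

theorem eval₂_primePowPoly {S : Type*} [CommSemiring S] (i : F →+* S) (x : S) :
    (primePowPoly F r k).eval₂ i x = ∑ l ∈ Finset.range r, (x ^ r ^ k) ^ l := by
  rw [primePowPoly, eval₂_finsetSum]
  simp [eval₂_pow]

theorem sum_root_pow_eq_zero :
    ∑ l ∈ Finset.range r, (AdjoinRoot.root (primePowPoly F r k) ^ r ^ k) ^ l = 0 := by
  rw [← eval₂_primePowPoly (AdjoinRoot.of _)]
  exact AdjoinRoot.eval₂_root _

/-- The Schönhage–Strassen bound: multiplication by a fixed element modulo `primePowPoly F r k` costs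
`O(r ^ k * k * log k)`.  The number of levels of the recursion is `e`, each of them about halves
`k`, and each contributes `O(2 ^ e)` per coefficient, since the number of multiplications doubles. -/
theorem Computes.primePow_mul {ι : Type*} (hr : r = 2 ∨ r = 3) (hrF : (r : F) ≠ 0) (e k : ℕ)
    (hk : k ≤ 2 ^ e + 1) {D : ℕ} (hr2 : 2 ≤ r) (hD : D = (r - 1) * r ^ k)
    (g : AdjoinRoot (primePowPoly F r k)) (f : (ι → F) → AdjoinRoot (primePowPoly F r k)) :
    Computes (coords (primePowBasis hr2 hD) f) (coords (primePowBasis hr2 hD) fun v => g * f v)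
      (r ^ k * (2 ^ e * (72 + 43 * e))) := by
  have hr3 : r ≤ 3 := by omega
  induction e generalizing k D with
  | zero =>
    -- for `k ≤ 2` the dimension is bounded and the schoolbook bound suffices
    refine (Computes.coords_mul_naive _ g f).mono_cost ?_
    have h1 : r ^ k ≤ 9 := (Nat.pow_le_pow_left hr3 k).trans
      (Nat.pow_le_pow_right (by norm_num) (show k ≤ 2 by simpa using hk))
    have h2 : D ≤ 2 * r ^ k := hD ▸ Nat.mul_le_mul_right _ (by omega)
    calc D * (D * 2) ≤ (2 * r ^ k) * ((2 * 9) * 2) :=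
          Nat.mul_le_mul h2 (Nat.mul_le_mul_right _ (h2.trans (by omega)))
      _ = _ := by ring
  | succ e ih =>
    by_cases hk' : k ≤ 2 ^ e + 1
    · refine (ih k hk' hD g f).mono_cost (Nat.mul_le_mul_left _ (Nat.mul_le_mul ?_ ?_))
      · exact Nat.pow_le_pow_right (by norm_num) (Nat.le_succ e)
      · omega
    · obtain ⟨a, c, ha, hca, hac, hc⟩ : ∃ a c, a ≤ 2 ^ e + 1 ∧ c ≤ a ∧ k = a + c ∧ c ≤ 2 ^ e := by
        rw [pow_succ] at hk
        exact ⟨(k + 1) / 2, k / 2, by omega, by omega, by omega, by omega⟩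
      subst hac
      have hD' : D = (r - 1) * r ^ a * r ^ c := by rw [hD, pow_add, mul_assoc]
      subst hD'
      let φ : AdjoinRoot (primePowPoly F r a) →ₐ[F] AdjoinRoot (primePowPoly F r (a + c)) :=
        AdjoinRoot.liftAlgHom _ (Algebra.ofId F _) (AdjoinRoot.root _ ^ r ^ c) (by
          have := sum_root_pow_eq_zero (F := F) (r := r) (k := a + c)
          rw [pow_add, mul_comm, pow_mul] at this
          rw [← this]
          exact eval₂_primePowPoly _ _)
      have hφ : φ (AdjoinRoot.root _) = AdjoinRoot.root _ ^ r ^ c := by simp [φ]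
      refine (Computes.coords_mul_step rfl rfl hr hrF hca (primePowBasis hr2 rfl)
        (primePowBasis hr2 hD) (primePowBasis_apply hr2 rfl) (primePowBasis_apply hr2 hD)
        sum_root_pow_eq_zero φ hφ (ih a ha rfl) g f).mono_cost ?_
      have h1 : r - 1 ≤ 2 := by omega
      calc r ^ c * (2 * (r ^ a * (2 ^ e * (72 + 43 * e))) + (24 * c + 19) * ((r - 1) * r ^ a))
          ≤ r ^ c * (2 * (r ^ a * (2 ^ e * (72 + 43 * e))) + (24 * 2 ^ e + 19 * 2 ^ e) *
            (2 * r ^ a)) := by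
            gcongr
            exact Nat.le_mul_of_pos_right _ (Nat.pow_pos (by norm_num))
        _ = r ^ (a + c) * (2 ^ (e + 1) * (72 + 43 * (e + 1))) := by ring

end RootPoly

section PolyMul

open Polynomial

variable {F ι : Type*} [Field F]

/-- The first `n` coefficients of a polynomial that depends on the inputs. -/
def coeffSet (n : ℕ) (f : (ι → F) → F[X]) : Set ((ι → F) → F) :=
  ⋃ i ∈ Finset.range n, {fun v => (f v).coeff i}

theorem coeffSet_mem {n i : ℕ} (hi : i < n) (f : (ι → F) → F[X]) :
    (fun v => (f v).coeff i) ∈ coeffSet n f := by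
  simp only [coeffSet, Set.mem_iUnion]
  exact ⟨i, Finset.mem_range.mpr hi, rfl⟩

theorem forall_mem_coeffSet {n : ℕ} {f : (ι → F) → F[X]} {P : ((ι → F) → F) → Prop} :
    (∀ p ∈ coeffSet n f, P p) ↔ ∀ i < n, P fun v => (f v).coeff i := by
  simp only [coeffSet, Set.mem_iUnion, Set.mem_singleton_iff, Finset.mem_range]
  exact ⟨fun h i hi => h _ ⟨i, hi, rfl⟩, fun h p ⟨i, hi, hp⟩ => hp ▸ h i hi⟩

/-- Per-coefficient cost of multiplying by a fixed polynomial when the product has degree less than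
`2 ^ (t + 1)`; up to a constant it is `t * log t`. -/
def mulRate (t : ℕ) : ℕ := 6 * (t + 1) * (72 + 43 * Nat.clog 2 (t + 1))

/-- Products of degree less than `N` are not changed by reduction modulo `primePowPoly F r k` with
`k = ⌈log_r N⌉`, for a radix `r` that is invertible in `F`. -/
theorem Computes.poly_mul {n N t : ℕ} (hN : N ≤ 2 ^ (t + 1)) {f : (ι → F) → F[X]} {g : F[X]}
    (hf : ∀ v, (f v).degree < n) (hfg : ∀ v, (f v * g).degree < N) (hn : n ≤ N) :
    Computes (coeffSet n f) (coeffSet N fun v => f v * g) (N * mulRate t) := by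
  rcases Nat.eq_zero_or_pos N with rfl | hN0
  · exact (Computes.of_subset (by simp [coeffSet])).mono_cost (Nat.zero_le _)
  obtain ⟨r, hr, hrF⟩ : ∃ r : ℕ, (r = 2 ∨ r = 3) ∧ (r : F) ≠ 0 := by
    by_cases h2 : ((2 : ℕ) : F) = 0
    · refine ⟨3, Or.inr rfl, fun h3 => one_ne_zero (α := F) ?_⟩
      push_cast at h2 h3
      linear_combination h3 - h2
    · exact ⟨2, Or.inl rfl, h2⟩
  have hr2 : 2 ≤ r := by omega
  set k := Nat.clog r N with hkdef
  have hNk : N ≤ r ^ k := Nat.le_pow_clog hr2 N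
  have hkN : r ^ k ≤ 3 * N := by
    rcases Nat.eq_zero_or_pos k with h0 | h0
    · rw [h0, pow_zero]; omega
    · have h1 : r ^ (k - 1) < N := by
        rw [← Nat.lt_clog_iff_pow_lt hr2]
        omega
      calc r ^ k = r * r ^ (k - 1) := by rw [← pow_succ']; congr 1; omega
        _ ≤ 3 * N := Nat.mul_le_mul (by omega) h1.le
  have hkt : k ≤ t + 1 := by
    refine Nat.clog_le_of_le_pow (hN.trans (Nat.pow_le_pow_left hr2 _))
  set e := Nat.clog 2 (t + 1)
  have hke : k ≤ 2 ^ e + 1 := hkt.trans ((Nat.le_pow_clog (by norm_num) _).trans (Nat.le_succ _))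
  have he : 2 ^ e ≤ 2 * (t + 1) := by
    rcases Nat.eq_zero_or_pos e with h0 | h0
    · rw [h0, pow_zero]; omega
    · have h1 : 2 ^ (e - 1) < t + 1 := by
        rw [← Nat.lt_clog_iff_pow_lt (by norm_num)]
        omega
      calc 2 ^ e = 2 * 2 ^ (e - 1) := by rw [← pow_succ']; congr 1; omega
        _ ≤ _ := Nat.mul_le_mul_left _ h1.le
  have hD : N ≤ (r - 1) * r ^ k := hNk.trans (Nat.le_mul_of_pos_left _ (by omega))
  have hred : ∀ p : F[X], p.degree < N → p %ₘ primePowPoly F r k = p := by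
    intro p hp
    rw [modByMonic_eq_self_iff (monic_primePowPoly hr2),
      degree_eq_natDegree (monic_primePowPoly hr2).ne_zero, natDegree_primePowPoly hr2]
    exact hp.trans_le (by exact_mod_cast hD)
  have hmul := Computes.primePow_mul (ι := ι) hr hrF e k hke hr2 rfl (AdjoinRoot.mk _ g)
    (fun v => AdjoinRoot.mk _ (f v))
  have hfN : ∀ v, (f v).degree < N := fun v => (hf v).trans_le (by exact_mod_cast hn)
  have c1 : Computes (coeffSet n f) (coords (primePowBasis hr2 rfl)
      (fun v => AdjoinRoot.mk (primePowPoly F r k) (f v))) 0 := by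
    refine Computes.of_forall_mem ?_
    rintro _ ⟨j, rfl⟩
    simp only [primePowBasis_repr, hred _ (hfN _)]
    by_cases hj : (j : ℕ) < n
    · exact Or.inl (coeffSet_mem hj f)
    · refine Or.inr ⟨0, funext fun v => coeff_eq_zero_of_degree_lt ((hf v).trans_le ?_)⟩
      exact_mod_cast not_lt.mp hj
  have c2 : Computes (coords (primePowBasis hr2 rfl)
      (fun v => AdjoinRoot.mk (primePowPoly F r k) g * AdjoinRoot.mk _ (f v)))
      (coeffSet N fun v => f v * g) 0 := by
    refine Computes.of_subset (forall_mem_coeffSet.mpr fun i hi => ?_)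
    refine ⟨⟨i, hi.trans_le hD⟩, funext fun v => ?_⟩
    simp only
    rw [← map_mul, primePowBasis_repr, mul_comm, hred _ (hfg v)]
  refine ((c1.trans hmul).trans c2).mono_cost ?_
  calc 0 + r ^ k * (2 ^ e * (72 + 43 * e)) + 0
      = r ^ k * (2 ^ e * (72 + 43 * e)) := by ring
    _ ≤ (3 * N) * ((2 * (t + 1)) * (72 + 43 * e)) := by gcongr
    _ = N * mulRate t := by simp only [mulRate, e]; ring

end PolyMul

/-! ### Fast interpolation and fast multi-modular reduction -/

section FastPoly

open Polynomial

variable {F ι : Type*} [Field F]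

theorem Computes.coeffSet_of_forall {X : Set ((ι → F) → F)} {c n : ℕ} {f : (ι → F) → F[X]}
    (h : ∀ i < n, Computes X {fun v => (f v).coeff i} c) : Computes X (coeffSet n f) (n * c) :=
  (Computes.biUnion_const (Finset.range n)
    fun i hi => h i (Finset.mem_range.mp hi)).mono_cost (by simp)

theorem Computes.coeffSet_add (n : ℕ) (f g : (ι → F) → F[X]) :
    Computes (coeffSet n f ∪ coeffSet n g) (coeffSet n fun v => f v + g v) n := by
  refine (Computes.coeffSet_of_forall (c := 1) fun i hi => ?_).mono_cost (by simp)
  refine (Computes.add (fun v => (f v).coeff i) (fun v => (g v).coeff i)).mono ?_ (by simp) le_rfl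
  rintro _ (rfl | rfl)
  · exact Or.inl (coeffSet_mem hi f)
  · exact Or.inr (coeffSet_mem hi g)

theorem Computes.coeffSet_sub {m n : ℕ} (hmn : m ≤ n) (f g : (ι → F) → F[X]) :
    Computes (coeffSet n f ∪ coeffSet n g) (coeffSet m fun v => f v - g v) n := by
  refine (Computes.coeffSet_of_forall (c := 1) fun i hi => ?_).mono_cost (by simpa using hmn)
  refine (Computes.sub (fun v => (f v).coeff i) (fun v => (g v).coeff i)).mono ?_ (by simp) le_rfl
  rintro _ (rfl | rfl)
  · exact Or.inl (coeffSet_mem (hi.trans_le hmn) f)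
  · exact Or.inr (coeffSet_mem (hi.trans_le hmn) g)

theorem degree_mul_lt_of_lt_of_le {p q : F[X]} {a b : ℕ} (hp : p.degree < a) (hq : q.degree ≤ b) :
    (p * q).degree < (a + b : ℕ) := by
  rw [degree_mul, Nat.cast_add]
  exact (add_le_add_right hq _).trans_lt (WithBot.add_lt_add_right (WithBot.natCast_ne_bot b) hp)

/-- The unscaled Lagrange form `∑ k ∈ s, a_k ∏_{j ∈ s, j ≠ k} (X - x_j)`. -/
def lagrangeSum {κ : Type*} [DecidableEq κ] (x : κ → F) (s : Finset κ) (a : κ → F) : F[X] :=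
  ∑ k ∈ s, C (a k) * Lagrange.nodal (s.erase k) x

theorem degree_lagrangeSum_lt {κ : Type*} [DecidableEq κ] (x : κ → F) (s : Finset κ) (a : κ → F) :
    (lagrangeSum x s a).degree < s.card := by
  rw [degree_lt_iff_coeff_zero]
  intro m hm
  rw [lagrangeSum, finsetSum_coeff]
  refine Finset.sum_eq_zero fun k hk => ?_
  rw [coeff_C_mul, coeff_eq_zero_of_degree_lt, mul_zero]
  rw [Lagrange.degree_nodal, Finset.card_erase_of_mem hk]
  have : 0 < s.card := Finset.card_pos.mpr ⟨k, hk⟩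
  exact_mod_cast (by omega : s.card - 1 < m)

theorem eval_lagrangeSum {κ : Type*} [DecidableEq κ] (x : κ → F) (s : Finset κ) (a : κ → F)
    {k : κ} (hk : k ∈ s) :
    (lagrangeSum x s a).eval (x k) = a k * ∏ j ∈ s.erase k, (x k - x j) := by
  rw [lagrangeSum, eval_finsetSum, Finset.sum_eq_single_of_mem k hk]
  · rw [eval_mul, eval_C, Lagrange.eval_nodal]
  · intro j _ hjk
    rw [eval_mul, Lagrange.eval_nodal_at_node (Finset.mem_erase.mpr ⟨hjk.symm, hk⟩), mul_zero]

theorem lagrangeSum_union {κ : Type*} [DecidableEq κ] (x : κ → F) {s₁ s₂ : Finset κ}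
    (h : Disjoint s₁ s₂) (a : κ → F) :
    lagrangeSum x (s₁ ∪ s₂) a = lagrangeSum x s₁ a * Lagrange.nodal s₂ x +
      lagrangeSum x s₂ a * Lagrange.nodal s₁ x := by
  have hnod : ∀ u w : Finset κ, Disjoint u w →
      Lagrange.nodal (u ∪ w) x = Lagrange.nodal u x * Lagrange.nodal w x := fun u w huw => by
    simp only [Lagrange.nodal, Finset.prod_union huw]
  simp only [lagrangeSum]
  rw [Finset.sum_union h, Finset.sum_mul, Finset.sum_mul]
  congr 1
  · refine Finset.sum_congr rfl fun k hk => ?_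
    rw [Finset.erase_union_distrib, Finset.erase_eq_of_notMem (Finset.disjoint_left.mp h hk),
      hnod _ _ (h.mono_left (Finset.erase_subset _ _)), mul_assoc]
  · refine Finset.sum_congr rfl fun k hk => ?_
    rw [Finset.erase_union_distrib, Finset.erase_eq_of_notMem (Finset.disjoint_right.mp h hk),
      hnod _ _ (h.mono_right (Finset.erase_subset _ _)), mul_assoc,
      mul_comm (Lagrange.nodal s₁ x)]

theorem exists_halves {κ : Type*} [DecidableEq κ] {s : Finset κ} {u : ℕ}
    (hs : s.card ≤ 2 ^ (u + 1)) : ∃ s₁ s₂ : Finset κ, Disjoint s₁ s₂ ∧ s₁ ∪ s₂ = s ∧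
      s₁.card ≤ 2 ^ u ∧ s₂.card ≤ 2 ^ u := by
  rw [pow_succ] at hs
  obtain ⟨s₁, h₁, h₂⟩ := Finset.exists_subset_card_eq (Nat.div_le_self s.card 2)
  refine ⟨s₁, s \ s₁, Finset.disjoint_sdiff, Finset.union_sdiff_of_subset h₁, by omega, ?_⟩
  rw [Finset.card_sdiff_of_subset h₁]
  omega

/-- Lagrange interpolation by divide and conquer. -/
theorem Computes.lagrangeSum {κ : Type*} [DecidableEq κ] (x : κ → F) (a : κ → (ι → F) → F)
    {t : ℕ} (u : ℕ) (s : Finset κ) (hu : s.card ≤ 2 ^ u) (ht : s.card ≤ 2 ^ (t + 1)) :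
    Computes (⋃ k ∈ s, {a k}) (coeffSet s.card fun v => lagrangeSum x s fun k => a k v)
      (s.card * (u * (2 * mulRate t + 1))) := by
  induction u generalizing s with
  | zero =>
    refine Computes.mono_cost (c := 0) ?_ (Nat.zero_le _)
    rw [pow_zero] at hu
    rcases Nat.le_one_iff_eq_zero_or_eq_one.mp hu with h | h
    · exact Computes.of_subset (by simp [coeffSet, h])
    · obtain ⟨k, rfl⟩ := Finset.card_eq_one.mp h
      exact Computes.of_subset (by simp [coeffSet, _root_.lagrangeSum])
  | succ u ih =>
    obtain ⟨s₁, s₂, hd, hs, h₁, h₂⟩ := exists_halves hu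
    have hcard : s₁.card + s₂.card = s.card := by rw [← hs, Finset.card_union_of_disjoint hd]
    let f₁ : (ι → F) → F[X] := fun v => _root_.lagrangeSum x s₁ fun k => a k v
    let f₂ : (ι → F) → F[X] := fun v => _root_.lagrangeSum x s₂ fun k => a k v
    have c₁ : Computes (⋃ k ∈ s, {a k}) (coeffSet s₁.card f₁) _ :=
      (ih s₁ h₁ (by omega)).mono (Set.biUnion_subset_biUnion_left fun k hk => by
        rw [← hs]; exact Finset.mem_union_left _ hk) subset_rfl le_rfl
    have c₂ : Computes (⋃ k ∈ s, {a k}) (coeffSet s₂.card f₂) _ :=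
      (ih s₂ h₂ (by omega)).mono (Set.biUnion_subset_biUnion_left fun k hk => by
        rw [← hs]; exact Finset.mem_union_right _ hk) subset_rfl le_rfl
    have m₁ := Computes.poly_mul (N := s.card) ht (f := f₁) (g := Lagrange.nodal s₂ x)
      (fun v => degree_lagrangeSum_lt _ _ _)
      (fun v => hcard ▸ degree_mul_lt_of_lt_of_le (degree_lagrangeSum_lt _ _ _)
        (Lagrange.degree_nodal (R := F)).le) (by omega)
    have m₂ := Computes.poly_mul (N := s.card) ht (f := f₂) (g := Lagrange.nodal s₁ x)
      (fun v => degree_lagrangeSum_lt _ _ _)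
      (fun v => (add_comm s₂.card _).trans hcard ▸ degree_mul_lt_of_lt_of_le
        (degree_lagrangeSum_lt _ _ _) (Lagrange.degree_nodal (R := F)).le) (by omega)
    have c₃ := ((c₁.trans m₁).union (c₂.trans m₂)).trans (Computes.coeffSet_add s.card _ _)
    refine c₃.mono subset_rfl ?_ (le_of_eq ?_)
    · simp only [← hs, lagrangeSum_union x hd]
      exact subset_rfl
    · rw [← hcard]; ring

theorem degree_lt_of_X_pow_mul {z : F[X]} {n m : ℕ}
    (h : (X ^ n * z).degree < ((n + m : ℕ) : WithBot ℕ)) :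
    z.degree < m := by
  rw [degree_lt_iff_coeff_zero] at h ⊢
  intro i hi
  rw [← coeff_X_pow_mul z n i]
  exact h _ (by omega)

theorem coeff_divByMonic_X_pow_eq (p : F[X]) (n i : ℕ) :
    (p /ₘ X ^ n).coeff i = p.coeff (i + n) := by
  conv_rhs => rw [← modByMonic_add_div p (X ^ n : F[X])]
  rw [coeff_add, coeff_X_pow_mul, eq_comm, add_eq_right, coeff_eq_zero_of_degree_lt]
  refine (degree_modByMonic_lt p (monic_X_pow n)).trans_le ?_
  rw [degree_X_pow]
  exact_mod_cast Nat.le_add_left n i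

/-- Barrett's formula: for `f` of degree less than `n`, the quotient of `f` by `G` is obtained from
the product of `f` by the fixed polynomial `⌊X ^ n / G⌋`. -/
theorem mod_eq_sub_barrett {f G : F[X]} (hG : G.Monic) {n : ℕ} (hf : f.degree < n) :
    f %ₘ G = f - (f * (X ^ n /ₘ G)) /ₘ X ^ n * G := by
  set I := X ^ n /ₘ G
  set ρ := (X ^ n : F[X]) %ₘ G
  set q := (f * I) /ₘ X ^ n
  set low := (f * I) %ₘ X ^ n
  have h1 : ρ + G * I = X ^ n := modByMonic_add_div _ _
  have h2 : low + X ^ n * q = f * I := modByMonic_add_div _ _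
  have hlow : low.degree < n := by
    have := degree_modByMonic_lt (f * I) (monic_X_pow n)
    rwa [degree_X_pow] at this
  have hρ : ρ.degree < G.natDegree := by
    rw [← degree_eq_natDegree hG.ne_zero]
    exact degree_modByMonic_lt _ hG
  have key : X ^ n * (f - q * G) = low * G + ρ * f := by
    linear_combination (-f) * h1 - G * h2
  refine (div_modByMonic_unique q (f - q * G) hG ⟨by ring, ?_⟩).2
  rw [degree_eq_natDegree hG.ne_zero]
  refine degree_lt_of_X_pow_mul (n := n) ?_
  rw [key]
  refine (degree_add_le _ _).trans_lt (max_lt ?_ ?_)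
  · exact degree_mul_lt_of_lt_of_le hlow degree_le_natDegree
  · rw [add_comm]
    exact degree_mul_lt_of_lt_of_le hρ hf.le

/-- Reduction modulo a fixed monic polynomial by two multiplications by fixed polynomials. -/
theorem Computes.modByMonic {n t : ℕ} (hn : 2 * n ≤ 2 ^ (t + 1)) {G : F[X]} (hG : G.Monic)
    (hGn : G.natDegree ≤ n) {f : (ι → F) → F[X]} (hf : ∀ v, (f v).degree < n) :
    Computes (coeffSet n f) (coeffSet G.natDegree fun v => f v %ₘ G)
      (n * (3 * mulRate t + 1)) := by
  let I : F[X] := X ^ n /ₘ G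
  let q : (ι → F) → F[X] := fun v => (f v * I) /ₘ X ^ n
  have hI : I.degree ≤ (n - G.natDegree : ℕ) := by
    refine degree_le_of_natDegree_le (le_of_eq ?_)
    rw [natDegree_divByMonic _ hG, natDegree_X_pow]
  have hfI : ∀ v, (f v * I).degree < (n + (n - G.natDegree) : ℕ) := fun v =>
    degree_mul_lt_of_lt_of_le (hf v) hI
  have hq : ∀ v, (q v).degree < (n - G.natDegree : ℕ) := by
    intro v
    rw [degree_lt_iff_coeff_zero]
    intro i hi
    rw [coeff_divByMonic_X_pow_eq]
    refine coeff_eq_zero_of_degree_lt ((hfI v).trans_le ?_)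
    exact_mod_cast (by omega)
  have hqG : ∀ v, (q v * G).degree < n := by
    intro v
    have := degree_mul_lt_of_lt_of_le (hq v) (degree_le_natDegree (p := G))
    rwa [Nat.sub_add_cancel hGn] at this
  have c₁ := Computes.poly_mul (N := 2 * n) hn hf (g := I)
    (fun v => (hfI v).trans_le (by exact_mod_cast (by omega))) (by omega)
  have c₂ : Computes (coeffSet (2 * n) fun v => f v * I) (coeffSet (n - G.natDegree) q) 0 := by
    refine Computes.of_subset (forall_mem_coeffSet.mpr fun i hi => ?_)
    simp only [q, coeff_divByMonic_X_pow_eq]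
    exact coeffSet_mem (f := fun v => f v * I) (by omega)
  have c₃ := Computes.poly_mul (N := n) (t := t) (by omega) hq hqG (Nat.sub_le _ _)
  have c₄ := ((Computes.of_subset (subset_refl (coeffSet n f))).union
    ((c₁.trans c₂).trans c₃)).trans (Computes.coeffSet_sub hGn f fun v => q v * G)
  refine c₄.mono subset_rfl ?_ (le_of_eq (by ring))
  simp only [mod_eq_sub_barrett hG (hf _)]
  exact subset_rfl

theorem modByMonic_modByMonic_of_dvd {f G H : F[X]} (hH : H.Monic) (h : H ∣ G) :
    (f %ₘ G) %ₘ H = f %ₘ H := by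
  refine modByMonic_eq_of_dvd_sub hH ?_
  have : f %ₘ G - f = G * -(f /ₘ G) := by
    linear_combination modByMonic_add_div f G
  rw [this]
  exact h.mul_right _

/-- Simultaneous reduction modulo several fixed monic polynomials by a remainder tree.  The tree is
balanced by the number of moduli; the degrees on each of its levels add up to that of the product. -/
theorem Computes.multi_modByMonic {κ : Type*} [DecidableEq κ] {G : κ → F[X]}
    (hG : ∀ q, (G q).Monic) {t : ℕ} (u : ℕ) (s : Finset κ) (hu : s.card ≤ 2 ^ u)
    (ht : 2 * (∏ q ∈ s, G q).natDegree ≤ 2 ^ (t + 1)) {f : (ι → F) → F[X]}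
    (hf : ∀ v, (f v).degree < (∏ q ∈ s, G q).natDegree) :
    Computes (coeffSet (∏ q ∈ s, G q).natDegree f)
      (⋃ q ∈ s, coeffSet (G q).natDegree fun v => f v %ₘ G q)
      ((∏ q ∈ s, G q).natDegree * (u * (2 * (3 * mulRate t + 1)))) := by
  have hprod : ∀ s : Finset κ, (∏ q ∈ s, G q).Monic := fun s =>
    monic_prod_of_monic _ _ fun q _ => hG q
  induction u generalizing s f with
  | zero =>
    refine Computes.mono_cost (c := 0) ?_ (Nat.zero_le _)
    rw [pow_zero] at hu
    rcases Nat.le_one_iff_eq_zero_or_eq_one.mp hu with h | h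
    · rw [Finset.card_eq_zero.mp h]
      exact Computes.of_subset (by simp)
    · obtain ⟨k, rfl⟩ := Finset.card_eq_one.mp h
      simp only [Finset.prod_singleton] at hf ⊢
      have : ∀ v, f v %ₘ G k = f v := fun v => by
        rw [modByMonic_eq_self_iff (hG k), degree_eq_natDegree (hG k).ne_zero]
        exact hf v
      exact Computes.of_subset (by simp [this])
  | succ u ih =>
    obtain ⟨s₁, s₂, hd, hs, h₁, h₂⟩ := exists_halves hu
    have hmul : ∏ q ∈ s, G q = (∏ q ∈ s₁, G q) * ∏ q ∈ s₂, G q := by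
      rw [← hs, Finset.prod_union hd]
    have hdeg : (∏ q ∈ s, G q).natDegree =
        (∏ q ∈ s₁, G q).natDegree + (∏ q ∈ s₂, G q).natDegree := by
      rw [hmul, (hprod s₁).natDegree_mul (hprod s₂)]
    have half : ∀ s' : Finset κ, s'.card ≤ 2 ^ u →
        (∏ q ∈ s', G q).natDegree ≤ (∏ q ∈ s, G q).natDegree →
        Computes (coeffSet (∏ q ∈ s, G q).natDegree f)
          (⋃ q ∈ s', coeffSet (G q).natDegree fun v => f v %ₘ G q)
          ((∏ q ∈ s, G q).natDegree * (3 * mulRate t + 1) +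
            (∏ q ∈ s', G q).natDegree * (u * (2 * (3 * mulRate t + 1)))) := by
      intro s' hs' hle
      have c₁ := Computes.modByMonic ht (hprod s') hle hf
      have c₂ := ih s' hs' (by omega) (f := fun v => f v %ₘ ∏ q ∈ s', G q) (fun v => by
        rw [← degree_eq_natDegree (hprod s').ne_zero]
        exact degree_modByMonic_lt _ (hprod s'))
      refine (c₁.trans c₂).mono subset_rfl (subset_of_eq ?_) le_rfl
      refine Set.iUnion₂_congr fun q hq => ?_
      simp only [modByMonic_modByMonic_of_dvd (hG q) (Finset.dvd_prod_of_mem G hq)]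
    refine ((half s₁ h₁ (by omega)).union (half s₂ h₂ (by omega))).mono subset_rfl ?_ (le_of_eq ?_)
    · rw [← hs, ← Finset.set_biUnion_union]
    · rw [hdeg]; ring

end FastPoly

/-! ### Pole orders of an FCSA code -/

section PoleOrders

variable {LA LB m : ℕ} {S : Finset (Fin LA × Fin LB)} {Q : TaskAssignment S m}

namespace TaskAssignment

/-- The number of products in group `q`. -/
def groupSize (Q : TaskAssignment S m) (q : Fin m) : ℕ := Q.sizeA q * Q.sizeB q

/-- The products in group `q`. -/
def group (Q : TaskAssignment S m) (q : Fin m) : Finset (Fin LA × Fin LB) :=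
  Q.groupA q ×ˢ Q.groupB q

theorem mem_group {q : Fin m} {s : Fin LA × Fin LB} :
    s ∈ Q.group q ↔ s.1 ∈ Q.groupA q ∧ s.2 ∈ Q.groupB q := Finset.mem_product

theorem card_group (q : Fin m) : (Q.group q).card = Q.groupSize q := Finset.card_product _ _

theorem sizeA_pos (Q : TaskAssignment S m) (q : Fin m) : 0 < Q.sizeA q :=
  Finset.card_pos.mpr (Q.nonemptyA q)

theorem sizeB_pos (Q : TaskAssignment S m) (q : Fin m) : 0 < Q.sizeB q :=
  Finset.card_pos.mpr (Q.nonemptyB q)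

theorem groupSize_pos (Q : TaskAssignment S m) (q : Fin m) : 0 < Q.groupSize q :=
  Nat.mul_pos (Q.sizeA_pos q) (Q.sizeB_pos q)

/-- The union of all the groups. -/
def allPairs (Q : TaskAssignment S m) : Finset (Fin LA × Fin LB) :=
  Finset.univ.biUnion Q.group

theorem card_allPairs (Q : TaskAssignment S m) : Q.allPairs.card = ∑ q, Q.groupSize q := by
  have h : (Q.allPairs).card = ∑ q, (Q.group q).card :=
    Finset.card_biUnion fun q _ q' _ h => Q.disjoint q q' h
  simpa only [card_group] using h

end TaskAssignment

/-- Two numbers `y * n - x` with `1 ≤ x ≤ n` agree only if their `y` and `x` agree. -/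
theorem mul_add_eq_mul_add_iff {n x x' y y' : ℕ} (hx : 1 ≤ x) (hxn : x ≤ n) (hx' : 1 ≤ x')
    (hxn' : x' ≤ n) (h : y * n + x' = y' * n + x) : y = y' ∧ x = x' := by
  rcases lt_trichotomy y y' with hy | rfl | hy
  · have := Nat.mul_le_mul_right n (Nat.succ_le_of_lt hy)
    rw [Nat.succ_mul] at this
    omega
  · omega
  · have := Nat.mul_le_mul_right n (Nat.succ_le_of_lt hy)
    rw [Nat.succ_mul] at this
    omega

namespace PowerAssignment

variable (P : PowerAssignment Q)

theorem powA_le (q : Fin m) (i : Fin LA) : P.powA q i ≤ Q.groupSize q := by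
  by_cases hi : i ∈ Q.groupA q
  · rcases P.form q with ⟨h, -⟩ | ⟨-, h⟩
    · obtain ⟨x, hx, h⟩ := h i hi
      rw [Finset.mem_Icc] at hx
      simp only [TaskAssignment.groupSize]; omega
    · obtain ⟨y, hy, h⟩ := h i hi
      rw [h]
      exact Nat.mul_le_mul_right _ (Finset.mem_Icc.mp hy).2
  · rw [P.zeroA q i hi]; exact Nat.zero_le _

theorem powB_le (q : Fin m) (j : Fin LB) : P.powB q j ≤ Q.groupSize q := by
  by_cases hj : j ∈ Q.groupB q
  · rcases P.form q with ⟨-, h⟩ | ⟨h, -⟩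
    · obtain ⟨y, hy, h⟩ := h j hj
      rw [h, TaskAssignment.groupSize, mul_comm (Q.sizeA q)]
      exact Nat.mul_le_mul_right _ (Finset.mem_Icc.mp hy).2
    · obtain ⟨x, hx, h⟩ := h j hj
      rw [Finset.mem_Icc] at hx
      simp only [TaskAssignment.groupSize]; omega
  · rw [P.zeroB q j hj]; exact Nat.zero_le _

theorem powA_pos {q : Fin m} {i : Fin LA} (hi : i ∈ Q.groupA q) : P.powA q i ≠ 0 := by
  have h1 := Q.sizeA_pos q
  have h2 := Q.sizeB_pos q
  rcases P.form q with ⟨h, -⟩ | ⟨-, h⟩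
  · obtain ⟨x, hx, h⟩ := h i hi
    rw [Finset.mem_Icc] at hx
    have := Nat.le_mul_of_pos_right (Q.sizeA q) h2
    omega
  · obtain ⟨y, hy, h⟩ := h i hi
    rw [h]
    exact Nat.mul_ne_zero (by have := (Finset.mem_Icc.mp hy).1; omega) h2.ne'

theorem powB_pos {q : Fin m} {j : Fin LB} (hj : j ∈ Q.groupB q) : P.powB q j ≠ 0 := by
  have h1 := Q.sizeA_pos q
  have h2 := Q.sizeB_pos q
  rcases P.form q with ⟨-, h⟩ | ⟨h, -⟩
  · obtain ⟨y, hy, h⟩ := h j hj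
    rw [h]
    exact Nat.mul_ne_zero (by have := (Finset.mem_Icc.mp hy).1; omega) h1.ne'
  · obtain ⟨x, hx, h⟩ := h j hj
    rw [Finset.mem_Icc] at hx
    have := Nat.le_mul_of_pos_left (Q.sizeB q) h1
    omega

theorem groupSize_lt_powA_add_powB {q : Fin m} {i : Fin LA} {j : Fin LB}
    (hi : i ∈ Q.groupA q) (hj : j ∈ Q.groupB q) :
    Q.groupSize q < P.powA q i + P.powB q j := by
  rw [TaskAssignment.groupSize]
  rcases P.form q with ⟨hA, hB⟩ | ⟨hB, hA⟩
  · obtain ⟨x, hx, h⟩ := hA i hi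
    obtain ⟨y, hy, h'⟩ := hB j hj
    rw [Finset.mem_Icc] at hx hy
    have := Nat.le_mul_of_pos_left (Q.sizeA q) (show 0 < y by omega)
    omega
  · obtain ⟨x, hx, h⟩ := hB j hj
    obtain ⟨y, hy, h'⟩ := hA i hi
    rw [Finset.mem_Icc] at hx hy
    have := Nat.le_mul_of_pos_left (Q.sizeB q) (show 0 < y by omega)
    omega

/-- Different products of a group have poles of different orders. -/
theorem pow_add_injective {q : Fin m} {i i' : Fin LA} {j j' : Fin LB}
    (hi : i ∈ Q.groupA q) (hj : j ∈ Q.groupB q) (hi' : i' ∈ Q.groupA q) (hj' : j' ∈ Q.groupB q)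
    (h : P.powA q i + P.powB q j = P.powA q i' + P.powB q j') : i = i' ∧ j = j' := by
  -- `P_i^A + P_j^B = L_q + 1 + (y * n - x)` with `1 ≤ x ≤ n` determines `x` and `y`
  suffices P.powA q i = P.powA q i' ∧ P.powB q j = P.powB q j' from
    ⟨P.distinctA q i i' (P.powA_pos hi) (P.powA_pos hi') this.1,
      P.distinctB q j j' (P.powB_pos hj) (P.powB_pos hj') this.2⟩
  rcases P.form q with ⟨hA, hB⟩ | ⟨hB, hA⟩
  · obtain ⟨x, hx, e1⟩ := hA i hi
    obtain ⟨y, hy, e2⟩ := hB j hj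
    obtain ⟨x', hx', e3⟩ := hA i' hi'
    obtain ⟨y', hy', e4⟩ := hB j' hj'
    rw [Finset.mem_Icc] at hx hx'
    have := mul_add_eq_mul_add_iff hx.1 hx.2 hx'.1 hx'.2 (y := y) (y' := y') (by omega)
    obtain ⟨rfl, rfl⟩ := this
    omega
  · obtain ⟨x, hx, e1⟩ := hB j hj
    obtain ⟨y, hy, e2⟩ := hA i hi
    obtain ⟨x', hx', e3⟩ := hB j' hj'
    obtain ⟨y', hy', e4⟩ := hA i' hi'
    rw [Finset.mem_Icc] at hx hx'
    have := mul_add_eq_mul_add_iff hx.1 hx.2 hx'.1 hx'.2 (y := y) (y' := y') (by omega)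
    obtain ⟨rfl, rfl⟩ := this
    omega

/-- The exponent of `x - f_q` in the coefficient of `A_i B_j` in `Θ(x) A(x) B(x)`. -/
def expo (q : Fin m) (s : Fin LA × Fin LB) : ℕ :=
  2 * Q.groupSize q - (P.powA q s.1 + P.powB q s.2)

theorem expo_add (q : Fin m) (s : Fin LA × Fin LB) :
    P.expo q s + (P.powA q s.1 + P.powB q s.2) = 2 * Q.groupSize q := by
  have h1 := P.powA_le q s.1
  have h2 := P.powB_le q s.2
  simp only [expo]; omega

theorem expo_lt {q : Fin m} {s : Fin LA × Fin LB} (hs : s ∈ Q.group q) :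
    P.expo q s < Q.groupSize q := by
  rw [TaskAssignment.mem_group] at hs
  have h1 := P.groupSize_lt_powA_add_powB hs.1 hs.2
  have h2 := P.expo_add q s
  omega

theorem le_expo {q : Fin m} {s : Fin LA × Fin LB} (hs : s ∉ Q.group q) :
    Q.groupSize q ≤ P.expo q s := by
  have h := P.expo_add q s
  rw [TaskAssignment.mem_group, not_and_or] at hs
  rcases hs with hs | hs
  · rw [P.zeroA q _ hs] at h
    have := P.powB_le q s.2
    omega
  · rw [P.zeroB q _ hs] at h
    have := P.powA_le q s.1
    omega

theorem expo_injOn (q : Fin m) : Set.InjOn (P.expo q) (Q.group q) := by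
  intro s hs s' hs' h
  rw [Finset.mem_coe, TaskAssignment.mem_group] at hs hs'
  have h1 := P.expo_add q s
  have h2 := P.expo_add q s'
  have := P.pow_add_injective hs.1 hs.2 hs'.1 hs'.2 (by omega)
  exact Prod.ext this.1 this.2

theorem sum_expo_lt_fcsaThreshold (s : Fin LA × Fin LB) :
    ((∑ q, P.expo q s : ℕ) : ℤ) < fcsaThreshold Q P := by
  have h1 : ((⨅ i, ∑ q, P.powA q i : ℕ) : ℤ) ≤ ∑ q, (P.powA q s.1 : ℤ) := by
    exact_mod_cast ciInf_le (OrderBot.bddBelow _) s.1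
  have h2 : ((⨅ j, ∑ q, P.powB q j : ℕ) : ℤ) ≤ ∑ q, (P.powB q s.2 : ℤ) := by
    exact_mod_cast ciInf_le (OrderBot.bddBelow _) s.2
  have h3 : (∑ q, (P.expo q s : ℤ)) + (∑ q, (P.powA q s.1 : ℤ) + ∑ q, (P.powB q s.2 : ℤ)) =
      2 * ∑ q, (Q.sizeA q : ℤ) * Q.sizeB q := by
    rw [← Finset.sum_add_distrib, ← Finset.sum_add_distrib, Finset.mul_sum]
    refine Finset.sum_congr rfl fun q _ => ?_
    have := P.expo_add q s
    rw [TaskAssignment.groupSize] at this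
    exact_mod_cast this
  simp only [fcsaThreshold]
  push_cast
  linarith

end PowerAssignment

end PoleOrders

/-! ### The numerator polynomial of the responses -/

section Numerator

open Polynomial

variable {F : Type*} [Field F] {LA LB m : ℕ} {S : Finset (Fin LA × Fin LB)}
  {Q : TaskAssignment S m} (P : PowerAssignment Q) (f : Fin m → F)

/-- `∏_q (X - f_q)^(2 L_q - P_i^{A,q} - P_j^{B,q})`. -/
def pairPoly (s : Fin LA × Fin LB) : F[X] := ∏ q, (X - C (f q)) ^ P.expo q s

/-- The polynomial `Θ(x) A(x) B(x)` for scalar products `c (i, j)` in place of `A_i B_j`, where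
`Θ(x) = ∏_q (x - f_q)^{L_q}`. -/
def numerator : (Fin LA × Fin LB → F) →ₗ[F] F[X] :=
  ∑ s, (LinearMap.proj s).smulRight (pairPoly P f s)

theorem numerator_apply (c : Fin LA × Fin LB → F) :
    numerator P f c = ∑ s, C (c s) * pairPoly P f s := by
  simp [numerator, LinearMap.sum_apply, smul_eq_C_mul]

theorem natDegree_pairPoly (s : Fin LA × Fin LB) :
    (pairPoly P f s).natDegree = ∑ q, P.expo q s := by
  rw [pairPoly, natDegree_prod_of_monic _ _ fun q _ => (monic_X_sub_C _).pow _]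
  simp

theorem degree_numerator_lt {R : ℕ} (hR : (R : ℤ) = fcsaThreshold Q P)
    (c : Fin LA × Fin LB → F) : (numerator P f c).degree < R := by
  rw [numerator_apply, degree_lt_iff_coeff_zero]
  intro n hn
  rw [finsetSum_coeff]
  refine Finset.sum_eq_zero fun s _ => ?_
  rw [coeff_C_mul, coeff_eq_zero_of_natDegree_lt, mul_zero]
  rw [natDegree_pairPoly]
  have := P.sum_expo_lt_fcsaThreshold s
  rw [← hR] at this
  exact (Nat.cast_lt.mp this).trans_le hn

theorem eval_pairPoly {x : F} (hx : ∀ q, x ≠ f q) (s : Fin LA × Fin LB) :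
    (pairPoly P f s).eval x = poleProd f (fun q => Q.sizeA q * Q.sizeB q) x *
      (poleProd f (fun q => Q.sizeA q * Q.sizeB q) x *
        ((poleProd f (fun q => P.powA q s.1) x)⁻¹ * (poleProd f (fun q => P.powB q s.2) x)⁻¹)) := by
  simp only [pairPoly, poleProd, eval_prod, eval_pow, eval_sub, eval_X, eval_C,
    ← Finset.prod_inv_distrib, ← Finset.prod_mul_distrib]
  refine Finset.prod_congr rfl fun q _ => ?_
  have h0 : x - f q ≠ 0 := sub_ne_zero.mpr (hx q)
  have h := P.expo_add q s
  rw [TaskAssignment.groupSize] at h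
  rw [← mul_inv, ← pow_add, ← mul_assoc, ← pow_add, ← two_mul, ← h, pow_add _ (P.expo q s),
    mul_inv_cancel_right₀ (pow_ne_zero _ h0)]

variable {f}

/-- The products of group `q` can be read off the numerator modulo `(X - f_q)^{L_q}`: the terms of
the group have distinct orders below `L_q` at `f_q`, and all the other terms vanish to order `L_q`. -/
theorem eq_zero_of_pow_dvd_numerator (hf : Function.Injective f) {c : Fin LA × Fin LB → F}
    {q : Fin m} (h : (X - C (f q)) ^ Q.groupSize q ∣ numerator P f c) {s : Fin LA × Fin LB}
    (hs : s ∈ Q.group q) : c s = 0 := by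
  classical
  by_contra hcs
  obtain ⟨s₀, hs₀, hmin⟩ := Finset.exists_min_image ((Q.group q).filter fun s => c s ≠ 0) (P.expo q)
    ⟨s, Finset.mem_filter.mpr ⟨hs, hcs⟩⟩
  rw [Finset.mem_filter] at hs₀
  have hsplit : ∀ s, pairPoly P f s = (X - C (f q)) ^ P.expo q s *
      ∏ q' ∈ Finset.univ.erase q, (X - C (f q')) ^ P.expo q' s := fun s => by
    rw [pairPoly, Finset.mul_prod_erase _ (fun q => (X - C (f q)) ^ P.expo q s) (Finset.mem_univ q)]
  -- `s₀` is the term of lowest order at `f_q`, and all the others have a higher order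
  have hother : ∀ s ≠ s₀, (X - C (f q)) ^ (P.expo q s₀ + 1) ∣ C (c s) * pairPoly P f s := by
    intro s hne
    by_cases hc : c s = 0
    · simp [hc]
    refine Dvd.dvd.mul_left ?_ _
    rw [hsplit]
    refine Dvd.dvd.mul_right (pow_dvd_pow _ ?_) _
    by_cases hs : s ∈ Q.group q
    · have h1 := hmin s (Finset.mem_filter.mpr ⟨hs, hc⟩)
      have h2 : P.expo q s₀ ≠ P.expo q s := fun he =>
        hne (P.expo_injOn q hs₀.1 hs he).symm
      omega
    · exact (Nat.succ_le_of_lt (P.expo_lt hs₀.1)).trans (P.le_expo hs)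
  have hdvd : (X - C (f q)) ^ (P.expo q s₀ + 1) ∣ C (c s₀) * pairPoly P f s₀ := by
    have h1 : (X - C (f q)) ^ (P.expo q s₀ + 1) ∣ numerator P f c :=
      (pow_dvd_pow _ (Nat.succ_le_of_lt (P.expo_lt hs₀.1))).trans h
    rw [numerator_apply, ← Finset.add_sum_erase _ _ (Finset.mem_univ s₀)] at h1
    exact (dvd_add_left (Finset.dvd_sum fun s hs =>
      hother s (Finset.ne_of_mem_erase hs))).mp h1
  rw [hsplit, pow_succ, mul_left_comm] at hdvd
  have hroot := dvd_iff_isRoot.mp ((mul_dvd_mul_iff_left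
    (pow_ne_zero _ (X_sub_C_ne_zero (f q)))).mp hdvd)
  rw [IsRoot, eval_mul, eval_C, eval_prod] at hroot
  rcases mul_eq_zero.mp hroot with h0 | h0
  · exact hs₀.2 h0
  · obtain ⟨q', hq', h1⟩ := Finset.prod_eq_zero_iff.mp h0
    rw [eval_pow, eval_sub, eval_X, eval_C] at h1
    exact Finset.ne_of_mem_erase hq' (hf (sub_eq_zero.mp (eq_zero_of_pow_eq_zero h1))).symm

theorem natDegree_group_modulus (q : Fin m) :
    ((X - C (f q)) ^ Q.groupSize q).natDegree = Q.groupSize q := by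
  rw [natDegree_pow, natDegree_X_sub_C, mul_one]

/-- By `eq_zero_of_pow_dvd_numerator`, the functional `c ↦ c s` vanishes on the common kernel of the
coefficient functionals, so it is a linear combination of them. -/
theorem exists_group_functional (hf : Function.Injective f) {q : Fin m} {s : Fin LA × Fin LB}
    (hs : s ∈ Q.group q) : ∃ w : ℕ → F, ∀ c : Fin LA × Fin LB → F,
      c s = ∑ l ∈ Finset.range (Q.groupSize q),
        w l * (numerator P f c %ₘ (X - C (f q)) ^ Q.groupSize q).coeff l := by
  have hmon : ((X - C (f q)) ^ Q.groupSize q).Monic := (monic_X_sub_C _).pow _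
  let T : Fin (Q.groupSize q) → (Fin LA × Fin LB → F) →ₗ[F] F := fun l =>
    (lcoeff F l).comp ((modByMonicHom ((X - C (f q)) ^ Q.groupSize q)).comp (numerator P f))
  have hT : ∀ l c, T l c = (numerator P f c %ₘ (X - C (f q)) ^ Q.groupSize q).coeff l :=
    fun l c => rfl
  have hker : ⨅ l, LinearMap.ker (T l) ≤
      LinearMap.ker (LinearMap.proj s : (Fin LA × Fin LB → F) →ₗ[F] F) := by
    intro c hc
    rw [Submodule.mem_iInf] at hc
    rw [LinearMap.mem_ker, LinearMap.proj_apply]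
    refine eq_zero_of_pow_dvd_numerator P hf ?_ hs
    rw [← modByMonic_eq_zero_iff_dvd hmon]
    ext l
    rw [coeff_zero]
    by_cases hl : l < Q.groupSize q
    · exact hc ⟨l, hl⟩
    · refine coeff_eq_zero_of_degree_lt ((degree_modByMonic_lt _ hmon).trans_le ?_)
      rw [degree_eq_natDegree hmon.ne_zero, natDegree_group_modulus]
      exact_mod_cast not_lt.mp hl
  obtain ⟨w, hw⟩ := (Submodule.mem_span_range_iff_exists_fun F).mp
    (mem_span_of_iInf_ker_le_ker hker)
  refine ⟨fun l => if h : l < Q.groupSize q then w ⟨l, h⟩ else 0, fun c => ?_⟩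
  have := LinearMap.congr_fun hw c
  rw [LinearMap.proj_apply, LinearMap.sum_apply] at this
  rw [← this, Finset.sum_range]
  refine Finset.sum_congr rfl fun l _ => ?_
  simp only [l.2, dif_pos, LinearMap.smul_apply, hT, smul_eq_mul, Fin.eta]

/-- The total size of the groups is at most the threshold, since the products in the groups are
determined by the numerator. -/
theorem sum_groupSize_le (hf : Function.Injective f) {R : ℕ} (hR : (R : ℤ) = fcsaThreshold Q P) :
    ∑ q, Q.groupSize q ≤ R := by
  let ext0 : (Q.allPairs → F) →ₗ[F] (Fin LA × Fin LB → F) :=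
    LinearMap.pi fun s => if h : s ∈ Q.allPairs then LinearMap.proj ⟨s, h⟩ else 0
  have hext : ∀ c (s : Q.allPairs), ext0 c s = c s := fun c s => by simp [ext0]
  let T : (Q.allPairs → F) →ₗ[F] (Fin R → F) :=
    LinearMap.pi fun l => (lcoeff F l).comp ((numerator P f).comp ext0)
  have hT : Function.Injective T := by
    rw [← LinearMap.ker_eq_bot, LinearMap.ker_eq_bot']
    intro c hc
    have hzero : numerator P f (ext0 c) = 0 := by
      ext l
      rw [coeff_zero]
      by_cases hl : l < R
      · exact congrFun hc ⟨l, hl⟩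
      · exact coeff_eq_zero_of_degree_lt ((degree_numerator_lt P f hR _).trans_le
          (by exact_mod_cast not_lt.mp hl))
    funext s
    obtain ⟨q, -, hq⟩ := Finset.mem_biUnion.mp s.2
    rw [← hext c s]
    exact eq_zero_of_pow_dvd_numerator P hf (hzero ▸ dvd_zero _) hq
  have := LinearMap.finrank_le_finrank_of_injective hT
  simpa [Q.card_allPairs] using this

end Numerator

/-! ### The decoder and its cost -/

theorem pole_injective {F : Type*} {m K : ℕ} (pts : Fin m ⊕ Fin K ↪ F) :
    Function.Injective fun q => pts (Sum.inl q) :=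
  pts.injective.comp Sum.inl_injective

theorem eval_point_injective {F : Type*} {m K : ℕ} (pts : Fin m ⊕ Fin K ↪ F) :
    Function.Injective fun k => pts (Sum.inr k) :=
  pts.injective.comp Sum.inr_injective

section Decoder

open Polynomial

variable {F : Type*} [Field F] {LA LB m K : ℕ} {S : Finset (Fin LA × Fin LB)}
  {Q : TaskAssignment S m} (P : PowerAssignment Q) (pts : Fin m ⊕ Fin K ↪ F)

/-- The product of two linear combinations of matrices, entrywise. -/
theorem smul_sum_mul_sum_apply {α β γ : ℕ} (θ : F) (a : Fin LA → F) (b : Fin LB → F)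
    (A : Fin LA → Matrix (Fin α) (Fin β) F) (B : Fin LB → Matrix (Fin β) (Fin γ) F) (r : Fin α)
    (c : Fin γ) : ((θ • ∑ i, a i • A i) * ∑ j, b j • B j : Matrix (Fin α) (Fin γ) F) r c =
      ∑ s : Fin LA × Fin LB, (A s.1 * B s.2) r c * (θ * (a s.1 * b s.2)) := by
  rw [Fintype.sum_prod_type, Matrix.smul_mul, Matrix.sum_mul, Matrix.smul_apply, Matrix.sum_apply,
    Finset.smul_sum]
  refine Finset.sum_congr rfl fun i _ => ?_
  rw [Matrix.mul_sum, Matrix.sum_apply, Finset.smul_sum]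
  refine Finset.sum_congr rfl fun j _ => ?_
  simp only [Matrix.smul_mul, Matrix.mul_smul, Matrix.smul_apply, smul_eq_mul]
  ring

/-- Multiplying a response by `Θ` gives the value of the numerator polynomial. -/
theorem eval_numerator_eq {α β γ : ℕ}
    (d : (𝓡 : Finset (Fin K)) → (𝓡 → Matrix (Fin α) (Fin γ) F) → S → Matrix (Fin α) (Fin γ) F)
    (A : Fin LA → Matrix (Fin α) (Fin β) F) (B : Fin LB → Matrix (Fin β) (Fin γ) F) (k : Fin K)
    (r : Fin α) (c : Fin γ) :
    (numerator P (fun q => pts (Sum.inl q)) fun s => (A s.1 * B s.2) r c).eval (pts (Sum.inr k)) =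
      poleProd (fun q => pts (Sum.inl q)) (fun q => Q.sizeA q * Q.sizeB q) (pts (Sum.inr k)) *
        (show Matrix (Fin α) (Fin γ) F from
          (fcsaCode Q P α β γ pts d).encA A k * (fcsaCode Q P α β γ pts d).encB B k) r c := by
  have hx : ∀ q, pts (Sum.inr k) ≠ pts (Sum.inl q) := fun q h => by
    simpa using pts.injective h
  refine Eq.trans ?_ (congrArg _ (smul_sum_mul_sum_apply _ _ _ A B r c)).symm
  rw [numerator_apply, eval_finsetSum, Finset.mul_sum]
  refine Finset.sum_congr rfl fun s _ => ?_
  rw [eval_mul, eval_C, eval_pairPoly P (fun q => pts (Sum.inl q)) hx]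
  ring

/-- The group of a requested product. -/
def TaskAssignment.groupOf (Q : TaskAssignment S m) (s : S) : Fin m := (Q.cover s s.2).choose

theorem TaskAssignment.mem_groupOf (Q : TaskAssignment S m) (s : S) :
    (s : Fin LA × Fin LB) ∈ Q.group (Q.groupOf s) := (Q.cover s s.2).choose_spec.1

/-- The linear functional that reads a requested product off the numerator modulo
`(X - f_q)^{L_q}`. -/
def readOff (s : S) : ℕ → F :=
  (exists_group_functional P (pole_injective pts) (Q.mem_groupOf s)).choose

/-- The factor by which a response is multiplied in Lagrange interpolation of the numerator from the
workers in `T`. -/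
def interpWeight (Q : TaskAssignment S m) (T : Finset (Fin K)) (k : Fin K) : F :=
  poleProd (fun q => pts (Sum.inl q)) (fun q => Q.sizeA q * Q.sizeB q) (pts (Sum.inr k)) *
    (∏ j ∈ T.erase k, (pts (Sum.inr k) - pts (Sum.inr j)))⁻¹

/-- The polynomial interpolating `Θ` times the responses `y` of the workers in `T`. -/
def interpolant (Q : TaskAssignment S m) (T : Finset (Fin K)) (y : Fin K → F) : F[X] :=
  lagrangeSum (fun k => pts (Sum.inr k)) T fun k => interpWeight pts Q T k * y k

/-- One entry of the product `s`, from one entry `y` of each of the responses of the workers in `T`. -/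
def decodeEntry (T : Finset (Fin K)) (y : Fin K → F) (s : S) : F :=
  ∑ l ∈ Finset.range (Q.groupSize (Q.groupOf s)), readOff P pts s l *
    (interpolant pts Q T y %ₘ
      (X - C (pts (Sum.inl (Q.groupOf s)))) ^ Q.groupSize (Q.groupOf s)).coeff l

open Classical in
/-- The decoder: it uses `R` of the responses, and returns zero matrices if there are fewer. -/
def fcsaDecoder (α γ R : ℕ) (𝓡 : Finset (Fin K)) (Y : 𝓡 → Matrix (Fin α) (Fin γ) F) (s : S) :
    Matrix (Fin α) (Fin γ) F :=
  if h : R ≤ 𝓡.card then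
    Matrix.of fun r c => decodeEntry P pts (Finset.exists_subset_card_eq h).choose
      (fun k => if hk : k ∈ 𝓡 then Y ⟨k, hk⟩ r c else 0) s
  else 0

theorem interpolant_eq {T : Finset (Fin K)} {y : Fin K → F} {p : F[X]} (hp : p.degree < T.card)
    (hy : ∀ k ∈ T, p.eval (pts (Sum.inr k)) = poleProd (fun q => pts (Sum.inl q))
      (fun q => Q.sizeA q * Q.sizeB q) (pts (Sum.inr k)) * y k) :
    interpolant pts Q T y = p := by
  refine Polynomial.eq_of_degrees_lt_of_eval_index_eq T (v := fun k => pts (Sum.inr k))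
    ((eval_point_injective pts).injOn) (degree_lagrangeSum_lt _ _ _) hp fun k hk => ?_
  rw [hy k hk, interpolant,
    eval_lagrangeSum (fun k => pts (Sum.inr k)) T _ hk, interpWeight]
  have : ∏ j ∈ T.erase k, (pts (Sum.inr k) - pts (Sum.inr j)) ≠ 0 := by
    refine Finset.prod_ne_zero_iff.mpr fun j hj h => Finset.ne_of_mem_erase hj ?_
    exact (eval_point_injective pts (sub_eq_zero.mp h)).symm
  rw [mul_right_comm, inv_mul_cancel_right₀ this]

theorem fcsaDecoder_eq {α β γ R : ℕ} (hR : (R : ℤ) = fcsaThreshold Q P) {𝓡 : Finset (Fin K)}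
    (h : R ≤ 𝓡.card) (A : Fin LA → Matrix (Fin α) (Fin β) F)
    (B : Fin LB → Matrix (Fin β) (Fin γ) F) (Y : 𝓡 → Matrix (Fin α) (Fin γ) F)
    (hY : ∀ (k : 𝓡) r c, (numerator P (fun q => pts (Sum.inl q))
      fun s => (A s.1 * B s.2) r c).eval (pts (Sum.inr k)) =
        poleProd (fun q => pts (Sum.inl q)) (fun q => Q.sizeA q * Q.sizeB q) (pts (Sum.inr k)) *
          Y k r c) (s : S) :
    fcsaDecoder P pts α γ R 𝓡 Y s = A s.1.1 * B s.1.2 := by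
  obtain ⟨hsub, hcard⟩ := (Finset.exists_subset_card_eq h).choose_spec
  rw [fcsaDecoder, dif_pos h]
  ext r c
  rw [Matrix.of_apply, decodeEntry, interpolant_eq pts
    (p := numerator P (fun q => pts (Sum.inl q)) fun s => (A s.1 * B s.2) r c)
    (by rw [hcard]; exact degree_numerator_lt P _ hR _)]
  · exact ((exists_group_functional P (pole_injective pts) (Q.mem_groupOf s)).choose_spec
      (fun s => (A s.1 * B s.2) r c)).symm
  · intro k hk
    rw [dif_pos (hsub hk)]
    exact hY ⟨k, hsub hk⟩ r c

theorem fcsaDecoder_eq_zero {α γ R : ℕ} {𝓡 : Finset (Fin K)} (h : ¬ R ≤ 𝓡.card)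
    (Y : 𝓡 → Matrix (Fin α) (Fin γ) F) (s : S) : fcsaDecoder P pts α γ R 𝓡 Y s = 0 := by
  rw [fcsaDecoder, dif_neg h]

theorem recoversFrom_fcsaDecoder (α β γ : ℕ) {R : ℕ} (hR : (R : ℤ) = fcsaThreshold Q P) :
    (fcsaCode Q P α β γ pts (fcsaDecoder P pts α γ R)).RecoversFrom R :=
  fun _ h𝓡 A B s => fcsaDecoder_eq P pts hR (by exact_mod_cast h𝓡) A B _
    (fun k r c => eval_numerator_eq P pts _ A B k r c) s

/-- The number of operations used to decode one entry of all the products. -/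
def entryCost (Q : TaskAssignment S m) (R t : ℕ) : ℕ :=
  11 * (R * ((t + 1) * mulRate t)) + 2 * ∑ q, Q.groupSize q ^ 2

theorem mulRate_pos (t : ℕ) : 1 ≤ mulRate t := by
  simp only [mulRate]
  exact Nat.succ_le_of_lt (by positivity)

theorem Computes.decodeEntry {ι : Type*} {R t : ℕ} (hR : (R : ℤ) = fcsaThreshold Q P)
    (ht : R ≤ 2 ^ t) {T : Finset (Fin K)} (hT : T.card = R) (y : Fin K → (ι → F) → F) :
    Computes (⋃ k ∈ T, {y k})
      (⋃ s : S, {fun v => decodeEntry P pts T (fun k => y k v) s}) (entryCost Q R t) := by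
  set H : (ι → F) → F[X] := fun v => interpolant pts Q T fun k => y k v
  set G : Fin m → F[X] := fun q => (X - C (pts (Sum.inl q))) ^ Q.groupSize q with hGdef
  have hG : ∀ q, (G q).Monic := fun q => (monic_X_sub_C _).pow _
  have hGdeg : ∀ q, (G q).natDegree = Q.groupSize q := fun q =>
    natDegree_group_modulus (f := fun q => pts (Sum.inl q)) q
  have hprod : (∏ q, G q).Monic := monic_prod_of_monic _ _ fun q _ => hG q
  set N := (∏ q, G q).natDegree with hN
  have hNsum : N = ∑ q, Q.groupSize q := by
    rw [hN, natDegree_prod_of_monic _ _ fun q _ => hG q]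
    simp only [hGdeg]
  have hNR : N ≤ R := hNsum ▸ sum_groupSize_le P (pole_injective pts) hR
  have hmN : m ≤ N := by
    rw [hNsum]
    calc m = ∑ _q : Fin m, 1 := by simp
      _ ≤ _ := Finset.sum_le_sum fun q _ => Q.groupSize_pos q
  have h2R : 2 * R ≤ 2 ^ (t + 1) := by rw [pow_succ]; omega
  have hH : ∀ v, (H v).degree < R := fun v => hT ▸ degree_lagrangeSum_lt _ _ _
  have c₁ : Computes (⋃ k ∈ T, {y k}) (⋃ k ∈ T, {fun v => interpWeight pts Q T k * y k v})
      (R * 1) := by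
    rw [← hT]
    exact Computes.biUnion_const T fun k hk => (Computes.const_mul _ (y k)).mono
      (Set.subset_biUnion_of_mem (u := fun k => ({y k} : Set ((ι → F) → F))) hk) subset_rfl le_rfl
  have c₂ : Computes (⋃ k ∈ T, {fun v => interpWeight pts Q T k * y k v}) (coeffSet R H)
      (R * (t * (2 * mulRate t + 1))) := by
    rw [← hT] at ht h2R ⊢
    exact Computes.lagrangeSum (fun k => pts (Sum.inr k))
      (fun k v => interpWeight pts Q T k * y k v) t T ht (by omega)
  have c₃ : Computes (coeffSet R H) (coeffSet N fun v => H v %ₘ ∏ q, G q)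
      (R * (3 * mulRate t + 1)) := Computes.modByMonic h2R hprod hNR hH
  have c₄ := Computes.multi_modByMonic hG (t := t) t Finset.univ (by simp; omega) (by omega)
    (f := fun v => H v %ₘ ∏ q, G q) (fun v => by
      rw [← degree_eq_natDegree hprod.ne_zero]
      exact degree_modByMonic_lt _ hprod)
  have c₅ : Computes (⋃ q ∈ Finset.univ, coeffSet (G q).natDegree fun v =>
      (H v %ₘ ∏ q, G q) %ₘ G q) (⋃ s : S, {fun v => _root_.decodeEntry P pts T (fun k => y k v) s})
      (∑ q, Q.groupSize q * (Q.groupSize q * 2)) := by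
    have hred : ∀ q v, (H v %ₘ ∏ q, G q) %ₘ G q = H v %ₘ G q := fun q v =>
      modByMonic_modByMonic_of_dvd (hG q) (Finset.dvd_prod_of_mem G (Finset.mem_univ q))
    simp only [hred, hGdeg]
    have hgroup : ∀ q ∈ Finset.univ, Computes
        (⋃ q ∈ Finset.univ, coeffSet (Q.groupSize q) fun v => H v %ₘ G q)
        (⋃ s ∈ Finset.univ.filter (fun s : S => Q.groupOf s = q),
          {fun v => _root_.decodeEntry P pts T (fun k => y k v) s})
        (Q.groupSize q * (Q.groupSize q * 2)) := by
      intro q hq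
      have hcard : (Finset.univ.filter (fun s : S => Q.groupOf s = q)).card ≤ Q.groupSize q := by
        rw [← TaskAssignment.card_group]
        refine Finset.card_le_card_of_injOn (fun s => (s : Fin LA × Fin LB)) (fun s hs => ?_)
          Subtype.val_injective.injOn
        have : Q.groupOf s = q := by simpa using hs
        exact this ▸ Q.mem_groupOf s
      refine (Computes.biUnion_const (c := Q.groupSize q * 2) _ fun s hs => ?_).mono_cost
        (Nat.mul_le_mul_right _ hcard)
      obtain rfl : Q.groupOf s = q := (Finset.mem_filter.mp hs).2
      refine (Computes.linear_combination (Finset.range (Q.groupSize (Q.groupOf s)))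
        (fun l v => (H v %ₘ G (Q.groupOf s)).coeff l) (readOff P pts s)).mono ?_ subset_rfl
        (by simp)
      exact Set.subset_biUnion_of_mem
        (u := fun q => coeffSet (Q.groupSize q) fun v => H v %ₘ G q) hq
    refine (Computes.biUnion Finset.univ hgroup).mono subset_rfl ?_ le_rfl
    refine Set.iUnion_subset fun s => ?_
    refine subset_trans ?_ (Set.subset_biUnion_of_mem
      (u := fun q => ⋃ s ∈ Finset.univ.filter (fun s : S => Q.groupOf s = q),
        {fun v => _root_.decodeEntry P pts T (fun k => y k v) s})
      (Finset.mem_univ (Q.groupOf s)))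
    exact Set.subset_biUnion_of_mem
      (u := fun s => ({fun v => _root_.decodeEntry P pts T (fun k => y k v) s} :
        Set ((ι → F) → F))) (by simp)
  refine ((((c₁.trans c₂).trans c₃).trans c₄).trans c₅).mono_cost ?_
  have hμ := mulRate_pos t
  have hsum : ∑ q, Q.groupSize q * (Q.groupSize q * 2) = 2 * ∑ q, Q.groupSize q ^ 2 := by
    rw [Finset.mul_sum]
    exact Finset.sum_congr rfl fun q _ => by ring
  rw [hsum, entryCost]
  refine Nat.add_le_add_right ?_ _
  calc R * 1 + R * (t * (2 * mulRate t + 1)) + R * (3 * mulRate t + 1) +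
        N * (t * (2 * (3 * mulRate t + 1)))
      ≤ R * 1 + R * (t * (2 * mulRate t + 1)) + R * (3 * mulRate t + 1) +
        R * (t * (2 * (3 * mulRate t + 1))) := by gcongr
    _ = R * (2 * 1 + 3 * mulRate t + t * (8 * mulRate t + 3 * 1)) := by ring
    _ ≤ R * (2 * mulRate t + 3 * mulRate t + t * (8 * mulRate t + 3 * mulRate t)) := by gcongr
    _ ≤ R * (11 * mulRate t + t * (11 * mulRate t)) := by
        refine Nat.mul_le_mul_left _ (Nat.add_le_add (by omega) (Nat.mul_le_mul_left _ (by omega)))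
    _ = 11 * (R * ((t + 1) * mulRate t)) := by ring

theorem arithCost_fcsaDecoder_le (α γ : ℕ) {R t : ℕ} (hR : (R : ℤ) = fcsaThreshold Q P)
    (ht : R ≤ 2 ^ t) {𝓡 : Finset (Fin K)} (h𝓡 : 𝓡.card = R) :
    arithCost (fun (v : (_ : 𝓡) × (Fin α × Fin γ) → F) (o : S × Fin α × Fin γ) =>
      fcsaDecoder P pts α γ R 𝓡 (fun k => Matrix.of fun r c => v ⟨k, (r, c)⟩) o.1 o.2.1 o.2.2) ≤
      ((α * γ * entryCost Q R t : ℕ) : ℝ≥0∞) := by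
  refine arithCost_le ?_
  have h : R ≤ 𝓡.card := h𝓡.ge
  obtain ⟨hsub, hcard⟩ := (Finset.exists_subset_card_eq h).choose_spec
  set T := (Finset.exists_subset_card_eq h).choose with hT
  have hentry := fun (rc : Fin α × Fin γ) => Computes.decodeEntry P pts
    (ι := (_ : 𝓡) × (Fin α × Fin γ)) hR ht hcard
    (fun k v => if hk : k ∈ 𝓡 then v ⟨⟨k, hk⟩, rc⟩ else 0)
  have hall := Computes.biUnion_const (Finset.univ : Finset (Fin α × Fin γ))
    (X := Set.range fun (i : (_ : 𝓡) × (Fin α × Fin γ)) (v : (_ : 𝓡) × (Fin α × Fin γ) → F) => v i)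
    fun rc _ => (hentry rc).mono (Set.iUnion₂_subset fun k hk => by
      rw [Set.singleton_subset_iff]
      simp only [hsub hk, dif_pos]
      exact ⟨_, rfl⟩) subset_rfl le_rfl
  refine hall.mono subset_rfl ?_ (by simp)
  rintro _ ⟨⟨s, r, c⟩, rfl⟩
  simp only [Set.mem_iUnion, Set.mem_singleton_iff]
  refine ⟨(r, c), Finset.mem_univ _, s, ?_⟩
  funext v
  rw [fcsaDecoder, dif_pos h]
  rfl

end Decoder

/-! ### Logarithmic estimates -/

theorem clog_le_of_log_le {n : ℕ} (hn : 1 ≤ n) :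
    (Nat.clog 2 n : ℝ) ≤ 1 + Real.log n / Real.log 2 := by
  have hlog2 : 0 < Real.log 2 := Real.log_pos (by norm_num)
  have hlogn : 0 ≤ Real.log n := Real.log_nonneg (by exact_mod_cast hn)
  rcases Nat.eq_zero_or_pos (Nat.clog 2 n) with h0 | h0
  · rw [h0, Nat.cast_zero]
    linarith [div_nonneg hlogn hlog2.le]
  · have h1 : 2 ^ (Nat.clog 2 n - 1) < n := by
      rw [← Nat.lt_clog_iff_pow_lt (by norm_num)]; omega
    have h2 : ((Nat.clog 2 n - 1 : ℕ) : ℝ) * Real.log 2 ≤ Real.log n := by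
      rw [← Real.log_pow]
      exact Real.log_le_log (by positivity) (by exact_mod_cast h1.le)
    rw [Nat.cast_sub h0, Nat.cast_one] at h2
    rw [← sub_le_iff_le_add', le_div_iff₀ hlog2]
    exact h2

/-- `(t + 1) * mulRate t = O(log² R * log log R)` for `t = ⌈log₂ R⌉`. -/
theorem mulRate_clog_le {R : ℕ} (hR : 2 ≤ R) :
    (((Nat.clog 2 R + 1) * mulRate (Nat.clog 2 R) : ℕ) : ℝ) ≤
      49500 * (Real.log R ^ 2 * max 1 (Real.log (Real.log R))) := by
  -- `t + 1 ≤ 5 log R` and `⌈log₂ (t + 1)⌉ ≤ 6 max(1, log log R)`; `49500 = 6 * 5 ^ 2 * (72 + 43 * 6)`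
  set t := Nat.clog 2 R
  set l := Real.log R with hl
  set M := max 1 (Real.log l) with hM
  have hM1 : 1 ≤ M := le_max_left _ _
  have hlog2 : 0.693 < Real.log 2 := lt_trans (by norm_num) Real.log_two_gt_d9
  have hl2 : Real.log 2 ≤ l := Real.log_le_log (by norm_num) (by exact_mod_cast hR)
  have hl0 : 0 < l := by linarith
  have ht : (t : ℝ) + 1 ≤ 5 * l := by
    have h1 : (t : ℝ) ≤ 1 + l / Real.log 2 := clog_le_of_log_le (by omega)
    have h2 : l / Real.log 2 ≤ l / 0.693 := by gcongr
    have h3 : l / 0.693 ≤ 1.45 * l := by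
      rw [div_le_iff₀ (by norm_num)]; nlinarith
    nlinarith
  have he : (Nat.clog 2 (t + 1) : ℝ) ≤ 6 * M := by
    have h1 : (Nat.clog 2 (t + 1) : ℝ) ≤ 1 + Real.log ((t + 1 : ℕ) : ℝ) / Real.log 2 :=
      clog_le_of_log_le (by omega)
    have h5 : Real.log 5 ≤ 2 := by
      rw [Real.log_le_iff_le_exp (by norm_num)]
      have : Real.exp 2 = Real.exp 1 * Real.exp 1 := by rw [← Real.exp_add]; norm_num
      rw [this]
      have := Real.exp_one_gt_d9
      nlinarith
    have h2 : Real.log ((t + 1 : ℕ) : ℝ) ≤ 3 * M := by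
      calc Real.log ((t + 1 : ℕ) : ℝ) ≤ Real.log (5 * l) :=
            Real.log_le_log (by positivity) (by push_cast; exact ht)
        _ = Real.log 5 + Real.log l := Real.log_mul (by norm_num) hl0.ne'
        _ ≤ 3 * M := by linarith [le_max_right 1 (Real.log l)]
    have h3 : Real.log ((t + 1 : ℕ) : ℝ) / Real.log 2 ≤ 3 * M / 0.693 := by gcongr
    have h4 : 3 * M / 0.693 ≤ 5 * M := by
      rw [div_le_iff₀ (by norm_num)]; nlinarith
    linarith
  calc (((t + 1) * mulRate t : ℕ) : ℝ)
      = 6 * (((t : ℝ) + 1) * ((t : ℝ) + 1)) * (72 + 43 * Nat.clog 2 (t + 1)) := by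
        simp only [mulRate]; push_cast; ring
    _ ≤ 6 * ((5 * l) * (5 * l)) * (72 * M + 43 * (6 * M)) := by gcongr; linarith
    _ = 49500 * (l ^ 2 * M) := by ring

/-- The cost of decoding one entry in terms of natural logarithms; `600000 ≥ 11 * 49500`. -/
theorem entryCost_le {LA LB m : ℕ} {S : Finset (Fin LA × Fin LB)} (Q : TaskAssignment S m) {R : ℕ}
    (hm : 0 < m) (hR : 1 ≤ R) :
    (entryCost Q R (Nat.clog 2 R) : ℝ) ≤ 600000 *
      ((R : ℝ) * Real.log R ^ 2 * max 1 (Real.log (Real.log R)) +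
        ∑ q, ((Q.sizeA q : ℝ) * Q.sizeB q) ^ 2) := by
  have hsum : ((∑ q, Q.groupSize q ^ 2 : ℕ) : ℝ) = ∑ q, ((Q.sizeA q : ℝ) * Q.sizeB q) ^ 2 := by
    simp [TaskAssignment.groupSize]
  have hsum1 : (1 : ℝ) ≤ ∑ q, ((Q.sizeA q : ℝ) * Q.sizeB q) ^ 2 := by
    rw [← hsum]
    have h1 : Q.groupSize ⟨0, hm⟩ ^ 2 ≤ ∑ q, Q.groupSize q ^ 2 :=
      Finset.single_le_sum (f := fun q => Q.groupSize q ^ 2) (fun _ _ => Nat.zero_le _)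
        (Finset.mem_univ _)
    exact_mod_cast (Nat.one_le_pow _ _ (Q.groupSize_pos _)).trans h1
  rw [entryCost, Nat.cast_add, Nat.cast_mul 2, hsum]
  rcases hR.eq_or_lt with rfl | hR2
  · -- `log 1 = 0`: the constant cost is absorbed by the sum over the groups
    have : mulRate 0 = 432 := by simp [mulRate]
    simp [this]
    linarith
  · have h1 := mulRate_clog_le hR2
    have hR0 : (0 : ℝ) ≤ R := Nat.cast_nonneg R
    have hnn : 0 ≤ (R : ℝ) * (Real.log R ^ 2 * max 1 (Real.log (Real.log R))) :=
      mul_nonneg hR0 (mul_nonneg (sq_nonneg _) (zero_le_one.trans (le_max_left _ _)))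
    have h2 := mul_le_mul_of_nonneg_left h1 hR0
    rw [Nat.cast_mul 11, Nat.cast_mul R, mul_assoc (R : ℝ)]
    push_cast at h2 ⊢
    linarith

/-! ### The cost measures of an FCSA code -/

theorem arithCost_le_card_mul {F ι κ κ' : Type*} [Field F] [Fintype κ'] {g : (ι → F) → (κ → F)}
    {c : ℕ} (e : κ' → κ) (he : Function.Surjective e)
    (h : ∀ o, Computes (Set.range fun (i : ι) (v : ι → F) => v i) {fun v => g v (e o)} c) :
    arithCost g ≤ ((Fintype.card κ' * c : ℕ) : ℝ≥0∞) := by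
  refine arithCost_le ((Computes.biUnion_const Finset.univ fun o _ => h o).mono subset_rfl ?_ ?_)
  · rintro _ ⟨o, rfl⟩
    obtain ⟨o', rfl⟩ := he o
    simp only [Set.mem_iUnion]
    exact ⟨o', Finset.mem_univ _, rfl⟩
  · rw [Finset.card_univ]

theorem mulCost_le (F : Type*) [Field F] (a b c : ℕ) :
    BatchCode.mulCost F a b c ≤ ((a * c * (b * 2) : ℕ) : ℝ≥0∞) := by
  refine (arithCost_le_card_mul (κ' := Fin a × Fin c) (c := b * 2) id Function.surjective_id
    fun o => ?_).trans (le_of_eq (by simp))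
  have := Computes.sum (X := Set.range fun (i : (Fin a × Fin b) ⊕ (Fin b × Fin c))
      (v : (Fin a × Fin b) ⊕ (Fin b × Fin c) → F) => v i) (c := 1) (Finset.univ : Finset (Fin b))
    (f := fun t v => v (Sum.inl (o.1, t)) * v (Sum.inr (t, o.2))) fun t _ =>
      (Computes.mul (fun v : (Fin a × Fin b) ⊕ (Fin b × Fin c) → F => v (Sum.inl (o.1, t)))
        (fun v => v (Sum.inr (t, o.2)))).mono (by
          rintro _ (rfl | rfl)
          · exact ⟨_, rfl⟩
          · exact ⟨_, rfl⟩) subset_rfl le_rfl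
  refine this.mono subset_rfl ?_ (by simp)
  simp [Matrix.mul_apply]

section CodeCosts

variable {F : Type*} [Field F] {LA LB m K : ℕ} {S : Finset (Fin LA × Fin LB)}
  {Q : TaskAssignment S m} (P : PowerAssignment Q) (pts : Fin m ⊕ Fin K ↪ F) (α β γ : ℕ)
  (d : (𝓡 : Finset (Fin K)) → (𝓡 → Matrix (Fin α) (Fin γ) F) → S → Matrix (Fin α) (Fin γ) F)

theorem computes_smul_sum_apply {n a b : ℕ} (θ : F) (w : Fin n → F) (r : Fin a) (c : Fin b) :
    Computes (Set.range fun (i : Fin n × Fin a × Fin b) (v : Fin n × Fin a × Fin b → F) => v i)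
      {fun v => (θ • ∑ i, w i • Matrix.of fun r c => v (i, r, c) : Matrix (Fin a) (Fin b) F) r c}
      (n * 2) := by
  refine (Computes.linear_combination Finset.univ
    (fun (i : Fin n) (v : Fin n × Fin a × Fin b → F) => v (i, r, c)) fun i => θ * w i).mono
      ?_ ?_ (by simp)
  · exact Set.iUnion₂_subset fun i _ => by
      rw [Set.singleton_subset_iff]; exact ⟨_, rfl⟩
  · rw [Set.singleton_subset_iff, Set.mem_singleton_iff]
    funext v
    simp [Matrix.sum_apply, Finset.mul_sum, mul_assoc]

theorem encodingComplexityA_le :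
    (fcsaCode Q P α β γ pts d).encodingComplexityA ≤ ((K * (α * β) * (LA * 2) : ℕ) : ℝ≥0∞) := by
  refine (arithCost_le_card_mul (κ' := Fin K × Fin α × Fin β) (c := LA * 2)
    (fun o => ⟨o.1, o.2⟩) (fun o => ⟨(o.1, o.2), rfl⟩) fun o => ?_).trans (le_of_eq (by simp))
  exact computes_smul_sum_apply _ _ o.2.1 o.2.2

theorem encodingComplexityB_le :
    (fcsaCode Q P α β γ pts d).encodingComplexityB ≤ ((K * (β * γ) * (LB * 2) : ℕ) : ℝ≥0∞) := by
  refine (arithCost_le_card_mul (κ' := Fin K × Fin β × Fin γ) (c := LB * 2)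
    (fun o => ⟨o.1, o.2⟩) (fun o => ⟨(o.1, o.2), rfl⟩) fun o => ?_).trans (le_of_eq (by simp))
  have := computes_smul_sum_apply (1 : F)
    (fun j => (poleProd (fun q => pts (Sum.inl q)) (fun q => P.powB q j) (pts (Sum.inr o.1)))⁻¹)
    o.2.1 o.2.2
  simp only [one_smul] at this
  exact this

theorem workerComplexity_le :
    (fcsaCode Q P α β γ pts d).workerComplexity ≤ ((α * γ * (β * 2) : ℕ) : ℝ≥0∞) := by
  refine ENNReal.div_le_of_le_mul ?_
  refine (Finset.sum_le_sum fun k _ => mulCost_le F α β γ).trans (le_of_eq ?_)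
  rw [Finset.sum_const, Finset.card_univ, Fintype.card_fin, nsmul_eq_mul, mul_comm]

theorem uploadCostA_eq (hK : 0 < K) :
    (fcsaCode Q P α β γ pts d).uploadCostA = (α : ℝ≥0∞) * β := by
  simp only [BatchCode.uploadCostA, fcsaCode, Finset.sum_const, Finset.card_univ, Fintype.card_fin,
    nsmul_eq_mul]
  rw [mul_comm (K : ℝ≥0∞)]
  exact ENNReal.mul_div_cancel_right (by exact_mod_cast hK.ne') (ENNReal.natCast_ne_top K)

theorem uploadCostB_eq (hK : 0 < K) :
    (fcsaCode Q P α β γ pts d).uploadCostB = (β : ℝ≥0∞) * γ := by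
  simp only [BatchCode.uploadCostB, fcsaCode, Finset.sum_const, Finset.card_univ, Fintype.card_fin,
    nsmul_eq_mul]
  rw [mul_comm (K : ℝ≥0∞)]
  exact ENNReal.mul_div_cancel_right (by exact_mod_cast hK.ne') (ENNReal.natCast_ne_top K)

theorem downloadCost_eq {R : ℕ} (hR : 0 < R) (hRK : R ≤ K) :
    (fcsaCode Q P α β γ pts d).downloadCost R = (α : ℝ≥0∞) * γ := by
  have h : ∀ 𝓡 : Finset (Fin K), (𝓡.card : ℤ) = R →
      (∑ k ∈ 𝓡, ((fcsaCode Q P α β γ pts d).rowDim k : ℝ≥0∞) *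
        (fcsaCode Q P α β γ pts d).colDim k) / 𝓡.card = (α : ℝ≥0∞) * γ := by
    intro 𝓡 h𝓡
    have h𝓡' : 𝓡.card ≠ 0 := by omega
    simp only [fcsaCode, Finset.sum_const, nsmul_eq_mul]
    rw [mul_comm (𝓡.card : ℝ≥0∞)]
    exact ENNReal.mul_div_cancel_right (by exact_mod_cast h𝓡') (ENNReal.natCast_ne_top _)
  refine le_antisymm (iSup₂_le fun 𝓡 h𝓡 => (h 𝓡 h𝓡).le) ?_
  obtain ⟨𝓡, -, h𝓡⟩ := Finset.exists_subset_card_eq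
    (show R ≤ (Finset.univ : Finset (Fin K)).card by simpa using hRK)
  exact (h 𝓡 (by exact_mod_cast h𝓡)).ge.trans
    (le_iSup₂_of_le 𝓡 (by exact_mod_cast h𝓡) le_rfl)

theorem decodingComplexity_le {R t : ℕ} (hR : (R : ℤ) = fcsaThreshold Q P) (ht : R ≤ 2 ^ t) :
    (fcsaCode Q P α β γ pts (fcsaDecoder P pts α γ R)).decodingComplexity R ≤
      ((α * γ * entryCost Q R t : ℕ) : ℝ≥0∞) :=
  iSup₂_le fun _ h𝓡 => arithCost_fcsaDecoder_le P pts α γ hR ht (by exact_mod_cast h𝓡)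

/-- From `R - 1` responses the decoder returns zero matrices, while some requested product is
nonzero. -/
theorem isRecoveryThreshold_fcsaDecoder {R : ℕ} (hR : (R : ℤ) = fcsaThreshold Q P) (hR0 : 0 < R)
    (hRK : R ≤ K) (hα : 0 < α) (hβ : 0 < β) (hγ : 0 < γ) (hS : S.Nonempty) :
    (fcsaCode Q P α β γ pts (fcsaDecoder P pts α γ R)).IsRecoveryThreshold R := by
  refine ⟨recoversFrom_fcsaDecoder P pts α β γ hR, fun n hn => ?_⟩
  by_contra hlt
  rw [not_le] at hlt
  obtain ⟨𝓡, -, h𝓡⟩ := Finset.exists_subset_card_eq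
    (show R - 1 ≤ (Finset.univ : Finset (Fin K)).card by simp; omega)
  obtain ⟨s, hs⟩ := hS
  have hdec : ∀ (Y : 𝓡 → Matrix (Fin α) (Fin γ) F) (s : S),
      (fcsaCode Q P α β γ pts (fcsaDecoder P pts α γ R)).dec 𝓡 Y s = 0 :=
    fcsaDecoder_eq_zero P pts (by omega)
  have h : (0 : Matrix (Fin α) (Fin γ) F) =
      (Matrix.of fun _ _ => 1 : Matrix (Fin α) (Fin β) F) *
        (Matrix.of fun r _ => if r = ⟨0, hβ⟩ then 1 else 0 : Matrix (Fin β) (Fin γ) F) :=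
    (hdec _ ⟨s, hs⟩).symm.trans (hn 𝓡 (by omega) (fun _ => Matrix.of fun _ _ => 1)
      (fun _ => Matrix.of fun r _ => if r = ⟨0, hβ⟩ then 1 else 0) ⟨s, hs⟩)
  have := congrFun (congrFun h ⟨0, hα⟩) ⟨0, hγ⟩
  simp [Matrix.mul_apply] at this

end CodeCosts

end

theorem theorem1 :
    ∃ C : ℕ, ∀ (F : Type*) [Field F] [Fintype F] (LA LB α β γ K m : ℕ)
      (S : Finset (Fin LA × Fin LB)) (Q : TaskAssignment S m) (P : PowerAssignment Q),
      0 < α → 0 < β → 0 < γ → 0 < K → S.Nonempty → m + K < Fintype.card F →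
      Nonempty (Fin m ⊕ Fin K ↪ F) ∧
      ∀ pts : Fin m ⊕ Fin K ↪ F,
        ∃ d : (𝓡 : Finset (Fin K)) → (𝓡 → Matrix (Fin α) (Fin γ) F) → S →
            Matrix (Fin α) (Fin γ) F,
          (fcsaCode Q P α β γ pts d).RecoversFrom (fcsaThreshold Q P) ∧
          (fcsaThreshold Q P ≤ K →
            (fcsaCode Q P α β γ pts d).IsRecoveryThreshold (fcsaThreshold Q P) ∧
            (fcsaCode Q P α β γ pts d).downloadCost (fcsaThreshold Q P) = (α : ℝ≥0∞) * γ) ∧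
          (fcsaCode Q P α β γ pts d).uploadCostA = (α : ℝ≥0∞) * β ∧
          (fcsaCode Q P α β γ pts d).uploadCostB = (β : ℝ≥0∞) * γ ∧
          (fcsaCode Q P α β γ pts d).encodingComplexityA ≤ (C : ℝ≥0∞) * (α * β * K * LA) ∧
          (fcsaCode Q P α β γ pts d).encodingComplexityB ≤ (C : ℝ≥0∞) * (β * γ * K * LB) ∧
          (fcsaCode Q P α β γ pts d).workerComplexity ≤ (C : ℝ≥0∞) * (α * β * γ) ∧
          (fcsaCode Q P α β γ pts d).decodingComplexity (fcsaThreshold Q P) ≤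
            ENNReal.ofReal (C * (α * γ *
              ((fcsaThreshold Q P : ℝ) * Real.log (fcsaThreshold Q P) ^ 2 *
                  max 1 (Real.log (Real.log (fcsaThreshold Q P)))
                + ∑ q, ((Q.sizeA q : ℝ) * Q.sizeB q) ^ 2))) := by
  refine ⟨600000, ?_⟩
  intro F _ _ LA LB α β γ K m S Q P hα hβ hγ hK hS hcard
  refine ⟨Function.Embedding.nonempty_of_card_le (by simpa using hcard.le), fun pts => ?_⟩
  obtain ⟨s, hs⟩ := hS
  have hpos : 0 < fcsaThreshold Q P :=
    lt_of_le_of_lt (Int.natCast_nonneg _) (P.sum_expo_lt_fcsaThreshold s)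
  obtain ⟨R, hR⟩ : ∃ R : ℕ, (R : ℤ) = fcsaThreshold Q P :=
    ⟨(fcsaThreshold Q P).toNat, Int.toNat_of_nonneg hpos.le⟩
  have hR0 : 0 < R := by omega
  have hm : 0 < m := Fin.pos (Q.groupOf ⟨s, hs⟩)
  have hRreal : ((fcsaThreshold Q P : ℤ) : ℝ) = (R : ℝ) := by rw [← hR, Int.cast_natCast]
  refine ⟨fcsaDecoder P pts α γ R, ?_, fun hRK => ?_, uploadCostA_eq P pts α β γ _ hK,
    uploadCostB_eq P pts α β γ _ hK, ?_, ?_, ?_, ?_⟩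
  · rw [← hR]
    exact recoversFrom_fcsaDecoder P pts α β γ hR
  · rw [← hR] at hRK ⊢
    have hRK' : R ≤ K := by exact_mod_cast hRK
    exact ⟨isRecoveryThreshold_fcsaDecoder P pts α β γ hR hR0 hRK' hα hβ hγ ⟨s, hs⟩,
      downloadCost_eq P pts α β γ _ hR0 hRK'⟩
  · refine (encodingComplexityA_le P pts α β γ _).trans ?_
    have : K * (α * β) * (LA * 2) ≤ 600000 * (α * β * K * LA) := by
      calc K * (α * β) * (LA * 2) = 2 * (α * β * K * LA) := by ring
        _ ≤ _ := Nat.mul_le_mul_right _ (by norm_num)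
    exact_mod_cast this
  · refine (encodingComplexityB_le P pts α β γ _).trans ?_
    have : K * (β * γ) * (LB * 2) ≤ 600000 * (β * γ * K * LB) := by
      calc K * (β * γ) * (LB * 2) = 2 * (β * γ * K * LB) := by ring
        _ ≤ _ := Nat.mul_le_mul_right _ (by norm_num)
    exact_mod_cast this
  · refine (workerComplexity_le P pts α β γ _).trans ?_
    have : α * γ * (β * 2) ≤ 600000 * (α * β * γ) := by
      calc α * γ * (β * 2) = 2 * (α * β * γ) := by ring
        _ ≤ _ := Nat.mul_le_mul_right _ (by norm_num)
    exact_mod_cast this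
  · have h1 := decodingComplexity_le P pts α β γ hR (Nat.le_pow_clog (by norm_num : 1 < 2) R)
    rw [hR] at h1
    refine h1.trans ?_
    rw [hRreal, ← ENNReal.ofReal_natCast]
    refine ENNReal.ofReal_le_ofReal ?_
    have h2 := entryCost_le Q hm hR0
    have h3 := mul_le_mul_of_nonneg_left h2 (Nat.cast_nonneg (α := ℝ) (α * γ))
    refine le_trans (le_of_eq (by push_cast; ring)) (h3.trans (le_of_eq (by push_cast; ring)))
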